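/- Let $\mathcal G=(\mathcal V,\mathcal E)$ be a weakly connected finite digraph whose nodes are agents with distinct, linearly ordered IDs. $u\rightsquigarrow v$ means that there is a directed path from $u$ to $v$; a strongly connected component (SCC) is a maximal set of pairwise mutually reachable nodes. A source SCC has an edge leaving it and none entering it; a target SCC has an edge entering it and none leaving it; an isolated SCC has neither. Let $\alpha$ and $\beta$ be the numbers of source and target SCCs. The representative of an SCC is its agent of lowest ID. The distributed augmentation algorithm works in synchronous rounds on the digraph $(\mathcal V,\mathcal E\cup\mathcal E^\ast)$, where initially $\mathcal E^\ast=\emptyset$. One round consists of the following phases; a phase starts when the preceding one has ended for all agents. Phase 1. Agent $u$ starts with the set $x_u^{(1)}$ of edges from $u$ to its out-neighbors. In iteration $k\ge 1$ it sends the edges that are new in $x_u^{(k)}$ (all of them if $k=1$) to all its out-neighbors, and obtains $x_u^{(k+1)}$ by adding to $x_u^{(k)}$ the edges received from its in-neighbors; it stops when no new edge was received in the last iteration. Then it computes, by Tarjan's algorithm, the SCCs of the digraph formed by $u$ and the edges it knows, and classifies them. If its own SCC is isolated, it finishes. If its own SCC is a source (target) SCC and $u$ is its representative, it takes part in Phase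 3 (Phases 2 and 4). Otherwise it waits for the next round. Phase 2. The representative $t$ of a target SCC sends the set $R_t$ of representatives of all source SCCs known to it to each element of $R_t$. Phase 3. Let $P_s$ be the set of those $t$ from which the representative $s$ of a source SCC has received a message $R_t$. If $|R_t|>1$ for some $t\in P_s$, then $s$ selects one such $t$, by linear search in the order of arrival, and sends $P_s$ to it. Otherwise it adds the edges $(t,s)$, $t\in P_s$, to $\mathcal E^\ast$. Phase 4. Let $Q_t$ be the set of those $s$ from which the representative $t$ of a target SCC has received a message $P_s$. If $|P_s|>1$ for some $s\in Q_t$, then $t$ selects one such $s$, by linear search in the order of arrival, and adds the edge $(t,s)$ to $\mathcal E^\ast$. Otherwise it adds the edges $(t,s)$, $s\in Q_t$, to $\mathcal E^\ast$. The time of an agent is the total number of elementary steps of its local computations from the start until it finishes (not counting idle waiting), on a unit-cost random access machine with tables addressed by IDs or pairs of IDs, where sending or receiving one ID or edge is one step. Claim. There is a universal constant $C$ such that, whenever $\alpha=1$ or $\beta=1$, for every order in which messages arrive: 1. after the first round, $\mathcal E^\ast$ is a set of edges of minimum cardinality for which $(\mathcal V,\mathcal E\cup\mathcal E^\ast)$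 is strongly connected; 2. no edge is added after the first round, and all agents finish in the second round; 3. the time of every agent, over the whole run, is at most $C\,|\mathcal V|\,|\mathcal E|$. -/

import Mathlib

namespace DigraphAugmentation

/-! ### Digraphs, strongly connected components and the augmentation problem

A digraph is a finite nonempty type `V` of nodes with a set `E : Finset (V × V)` of directed edges.
Self-loops are allowed. -/

section Digraphs

variable {V : Type}

/-- There is a directed path from `u` to `v` (possibly of length `0`). -/
def Reaches (E : Finset (V × V)) (u v : V) : Prop :=
  Relation.ReflTransGen (fun a b => (a, b) ∈ E) u v

/-- Any two distinct nodes reach each other. -/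
def StronglyConnected (E : Finset (V × V)) : Prop :=
  ∀ u v : V, u ≠ v → Reaches E u v ∧ Reaches E v u

/-- Any two nodes are joined by a path once the directions of the edges are ignored. -/
def WeaklyConnected (E : Finset (V × V)) : Prop :=
  ∀ u v : V, Relation.ReflTransGen (fun a b => (a, b) ∈ E ∨ (b, a) ∈ E) u v

/-- A strongly connected component: a maximal set of nodes that pairwise reach each other. -/
def IsSCC (E : Finset (V × V)) (S : Set V) : Prop :=
  Maximal (fun T : Set V => ∀ u ∈ T, ∀ v ∈ T, u ≠ v → Reaches E u v ∧ Reaches E v u) S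

/-- Some edge leaves `S`. -/
def HasOutEdge (E : Finset (V × V)) (S : Set V) : Prop :=
  ∃ e ∈ E, e.1 ∈ S ∧ e.2 ∉ S

/-- Some edge enters `S`. -/
def HasInEdge (E : Finset (V × V)) (S : Set V) : Prop :=
  ∃ e ∈ E, e.1 ∉ S ∧ e.2 ∈ S

/-- A source SCC. -/
def IsSourceSCC (E : Finset (V × V)) (S : Set V) : Prop :=
  IsSCC E S ∧ HasOutEdge E S ∧ ¬ HasInEdge E S

/-- A target SCC. -/
def IsTargetSCC (E : Finset (V × V)) (S : Set V) : Prop :=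
  IsSCC E S ∧ ¬ HasOutEdge E S ∧ HasInEdge E S

/-- The number of source SCCs. -/
noncomputable def numSourceSCCs (E : Finset (V × V)) : ℕ :=
  {S : Set V | IsSourceSCC E S}.ncard

/-- The number of target SCCs. -/
noncomputable def numTargetSCCs (E : Finset (V × V)) : ℕ :=
  {S : Set V | IsTargetSCC E S}.ncard

/-- `F` is a solution of the minimum cardinality digraph augmentation problem for `E`: adding `F`
makes the digraph strongly connected, and no smaller set of edges does. -/
def IsMinAugmentation [DecidableEq V] (E F : Finset (V × V)) : Prop :=
  StronglyConnected (E ∪ F) ∧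
    ∀ F' : Finset (V × V), StronglyConnected (E ∪ F') → F.card ≤ F'.card

end Digraphs

/-! ### Counting elementary steps

The local computations of an agent are written in a step-counting monad. The cost model is the
unit-cost random access machine with tables addressed by agent IDs (or by pairs of IDs): reading or
writing one table entry, comparing two IDs or two numbers, pushing or popping one list entry, and
sending or receiving one ID or one edge are charged as elementary steps. Functions such as `V → ℕ`,
and `Finset`s with membership test and insertion, stand for such tables. -/

/-- A result together with the number of elementary steps spent on computing it. -/
structure Timed (α : Type) where
  val : α
  time : ℕ

instance : Monad Timed where
  pure a := ⟨a, 0⟩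
  bind x f := ⟨(f x.val).val, x.time + (f x.val).time⟩

/-- Spend `n` elementary steps. -/
def charge (n : ℕ) : Timed Unit := ⟨(), n⟩

section Agents

variable {V : Type} [LinearOrder V]

/-! ### Phase 1, first part: edge propagation

Agents are identified with their IDs, hence the linear order on `V`. -/

/-- Memory of an agent during edge propagation: `seen` (a table) and `known` (a list) both hold the
set of edges known so far, and `fresh` lists those that became known in the last iteration. -/
structure PropMem (V : Type) where
  seen : Finset (V × V)
  known : List (V × V)
  fresh : List (V × V)

/-- Record one edge, unless it is known already. -/
def absorb (m : PropMem V) (e : V × V) : Timed (PropMem V) := do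
  charge 1
  if e ∈ m.seen then pure m
  else do
    charge 3
    pure ⟨insert e m.seen, e :: m.known, e :: m.fresh⟩

/-- At the beginning agent `u` knows the edges to its out-neighbors `out`. -/
def initMem (u : V) (out : List V) : Timed (PropMem V) :=
  (out.map fun v => (u, v)).foldlM absorb ⟨∅, [], []⟩

/-- Loop test of edge propagation in iteration `k ≥ 1`: the known edges changed in the
last iteration. In the first iteration there is no earlier set to compare with, and the loop is
entered. -/
def active (k : ℕ) (m : PropMem V) : Bool :=
  k == 1 || !m.fresh.isEmpty

/-- One iteration of edge propagation: the loop test, sending the fresh edges to all out-neighbors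
`out`, and recording the edges received; `inbox` has one message per in-neighbor. -/
def propagateBody (out : List V) (inbox : List (List (V × V))) (m : PropMem V) :
    Timed (PropMem V) := do
  charge 1
  charge (out.length * (1 + m.fresh.length))
  inbox.foldlM (fun m msg => do charge 1; msg.foldlM absorb m) { m with fresh := [] }

/-! ### Phase 1, second part: Tarjan's algorithm on the known edges -/

/-- A digraph in the memory of an agent, given by a list of nodes and adjacency lists; `marked` is a
table of the nodes that are on the list. -/
structure LocalGraph (V : Type) where
  nodes : List V
  marked : Finset V
  succs : V → List V

/-- Add a node to a digraph in memory, unless it is there already. -/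
def addNode (g : LocalGraph V) (v : V) : Timed (LocalGraph V) := do
  charge 1
  if v ∈ g.marked then pure g
  else do
    charge 2
    pure { g with nodes := v :: g.nodes, marked := insert v g.marked }

/-- Add an edge and its end nodes to a digraph in memory. -/
def addEdge (g : LocalGraph V) (e : V × V) : Timed (LocalGraph V) := do
  let g₁ ← addNode g e.1
  let g₂ ← addNode g₁ e.2
  charge 1
  pure { g₂ with succs := Function.update g₂.succs e.1 (e.2 :: g₂.succs e.1) }

/-- The digraph formed by agent `u` and the edges it knows. -/
def buildGraph (u : V) (known : List (V × V)) : Timed (LocalGraph V) := do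
  let g ← addNode ⟨[], ∅, fun _ => []⟩ u
  known.foldlM addEdge g

/-- State of Tarjan's algorithm: the next serial number, the serial number of each node (`none` for
a node not yet visited, `⊤` for a node whose component is complete), the stack, and the components
found so far. -/
structure TarjanState (V : Type) where
  next : ℕ
  num : V → Option (WithTop ℕ)
  stack : List V
  comps : List (List V)

/-- Pop the stack up to and including `x`, marking the nodes popped as complete. The result consists
of the nodes popped, the remaining stack and the new serial numbers. -/
def popUntil (x : V) : List V → (V → Option (WithTop ℕ)) → List V →
    Timed (List V × List V × (V → Option (WithTop ℕ)))
  | [], num, comp => pure (comp, [], num)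
  | y :: ys, num, comp => do
    charge 3
    if y = x then pure (y :: comp, ys, Function.update num y (some ⊤))
    else popUntil x ys (Function.update num y (some ⊤)) (y :: comp)

/-- Go through a list of nodes and visit those that have not been visited. The number returned is
the least serial number found. -/
def visitList (visit : V → TarjanState V → Timed (WithTop ℕ × TarjanState V)) :
    List V → TarjanState V → Timed (WithTop ℕ × TarjanState V)
  | [], s => do
    charge 1
    pure (⊤, s)
  | x :: xs, s => do
    charge 2
    let p ← (match s.num x with
      | some n => pure (n, s)
      | none => visit x s)
    let q ← visitList visit xs p.2
    charge 1
    pure (min p.1 q.1, q.2)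

/-- Tarjan's depth first search from the unvisited node `x`. The number returned is the least serial
number of an incomplete node found from `x`, if it is less than that of `x`; otherwise `x` is the
root of a component, which is popped from the stack. The first argument bounds the recursion depth;
it is always started with the number of nodes, so that it does not run out. -/
def visit (succs : V → List V) : ℕ → V → TarjanState V → Timed (WithTop ℕ × TarjanState V)
  | 0, _, s => pure (⊤, s)
  | d + 1, x, s => do
    charge 4
    let p ← visitList (visit succs d) (succs x)
      { s with next := s.next + 1
               num := Function.update s.num x (some (s.next : WithTop ℕ))
               stack := x :: s.stack }
    charge 1
    if p.1 < (s.next : WithTop ℕ) then pure p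
    else do
      let q ← popUntil x p.2.stack p.2.num []
      charge 1
      pure (⊤, { p.2 with num := q.2.2, stack := q.2.1, comps := q.1 :: p.2.comps })

/-- Tarjan's algorithm: the list of strongly connected components. -/
def tarjan (g : LocalGraph V) : Timed (List (List V)) := do
  charge g.nodes.length
  let p ← visitList (visit g.succs g.nodes.length) g.nodes ⟨0, fun _ => none, [], []⟩
  pure p.2.comps

/-! ### Phase 1, third part: classification -/

/-- The components known to an agent: the numbered components, the number of the component of each
node, and whether a known edge enters or leaves the component with a given number. -/
structure SCCTable (V : Type) where
  comps : List (List V × ℕ)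
  label : V → ℕ
  hasIn : ℕ → Bool
  hasOut : ℕ → Bool

/-- The phase to which an agent goes from Phase 1. -/
inductive Decision where
  | exit
  | phase3
  | phase2
  | wait

/-- Give number `p.2` to all nodes of the component `p.1`. -/
def labelComp (label : V → ℕ) (p : List V × ℕ) : Timed (V → ℕ) := do
  charge 1
  p.1.foldlM (fun l v => do charge 1; pure (Function.update l v p.2)) label

/-- Record that an edge between different components leaves one and enters the other. -/
def markEdge (T : SCCTable V) (e : V × V) : Timed (SCCTable V) := do
  charge 3
  if T.label e.1 = T.label e.2 then pure T
  else do
    charge 2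
    pure { T with hasIn := Function.update T.hasIn (T.label e.2) true
                  hasOut := Function.update T.hasOut (T.label e.1) true }

/-- The components of the digraph formed by `u` and the known edges, with their classification. -/
def computeSCCs (u : V) (known : List (V × V)) : Timed (SCCTable V) := do
  let g ← buildGraph u known
  let comps ← tarjan g
  charge comps.length
  let label ← comps.zipIdx.foldlM labelComp (fun _ => 0)
  known.foldlM markEdge ⟨comps.zipIdx, label, fun _ => false, fun _ => false⟩

/-- Linear search for the component with number `i`. -/
def findComp (i : ℕ) : List (List V × ℕ) → Timed (List V)
  | [] => pure []
  | p :: ps => do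
    charge 1
    if p.2 = i then pure p.1 else findComp i ps

/-- The lowest ID on a list. -/
def lowest : List V → Timed (Option V)
  | [] => pure none
  | v :: vs => do
    charge 1
    let m ← lowest vs
    match m with
    | none => pure (some v)
    | some w => pure (some (min v w))

/-- Second and third part of Phase 1, performed by agent `u` with the edges that it knows at the end
of edge propagation. The first charge is for the loop test that ends edge propagation. -/
def classify (u : V) (known : List (V × V)) : Timed (SCCTable V × Decision) := do
  charge 1
  let T ← computeSCCs u known
  charge 3
  let S ← findComp (T.label u) T.comps
  let m ← lowest S
  charge 3
  match T.hasIn (T.label u), T.hasOut (T.label u) with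
  | false, false => pure (T, Decision.exit)
  | false, true => pure (T, if m = some u then Decision.phase3 else Decision.wait)
  | true, false => pure (T, if m = some u then Decision.phase2 else Decision.wait)
  | true, true => pure (T, Decision.wait)

/-! ### Phases 2, 3 and 4 -/

/-- Phase 2, performed by the representative of a target SCC: collect the representatives of the
known source SCCs, and send the set of all of them to each of them. -/
def runPhase2 (T : SCCTable V) : Timed (List V) := do
  let R ← T.comps.foldlM (fun R p => do
    charge 3
    if T.hasIn p.2 = false ∧ T.hasOut p.2 = true then do
      let m ← lowest p.1
      charge 1
      pure (m.toList ++ R)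
    else pure R) ([] : List V)
  charge (R.length * (1 + R.length))
  pure R

/-- Read all messages `(sender, set of IDs)` of an inbox. -/
def receiveAll (inbox : List (V × List V)) : Timed Unit :=
  inbox.foldlM (fun _ p => charge (1 + p.2.length)) ()

/-- Linear search for a sender whose message has more than one element. -/
def findLarge : List (V × List V) → Timed (Option V)
  | [] => pure none
  | p :: ps => do
    charge 1
    if 1 < p.2.length then pure (some p.1) else findLarge ps

/-- Phase 3, performed by the representative `u` of a source SCC; `inbox` holds the proposals
`(t, R_t)`. If some `R_t` has more than one element, then one such `t` is selected, and the set of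
all senders is sent to it. Otherwise the edges `(t, u)` for all senders `t` are added. The result
is the selected target, if there is one, and the list of edges added. -/
def runPhase3 (u : V) (inbox : List (V × List V)) : Timed (Option V × List (V × V)) := do
  receiveAll inbox
  let t ← findLarge inbox
  match t with
  | some t => do
    charge (1 + inbox.length)
    pure (some t, [])
  | none => do
    charge inbox.length
    pure (none, inbox.map fun p => (p.1, u))

/-- Phase 4, performed by the representative `u` of a target SCC; `inbox` holds the proposals
`(s, P_s)`. If some `P_s` has more than one element, then one such `s` is selected, and the edge
`(u, s)` is added. Otherwise the edges `(u, s)` for all senders `s` are added. The result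
is the list of edges added. -/
def runPhase4 (u : V) (inbox : List (V × List V)) : Timed (List (V × V)) := do
  charge 1
  receiveAll inbox
  let s ← findLarge inbox
  match s with
  | some s => do
    charge 1
    pure [(u, s)]
  | none => do
    charge inbox.length
    pure (inbox.map fun p => (u, p.1))

end Agents

/-! ### The synchronous network -/

section Network

variable {V : Type} [Fintype V] [LinearOrder V]

/-- The out-neighbors of `u`. -/
def outNbrs (E : Finset (V × V)) (u : V) : List V :=
  (Finset.univ.filter fun v => (u, v) ∈ E).sort (· ≤ ·)

/-- The in-neighbors of `u`. -/
def inNbrs (E : Finset (V × V)) (u : V) : List V :=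
  (Finset.univ.filter fun v => (v, u) ∈ E).sort (· ≤ ·)

/-- State of the network: the number of completed rounds, the set of edges added so far, the current
iteration of edge propagation, the memories of the agents, the number of elementary steps
that each agent has performed since the start, and whether it has finished. -/
structure Config (V : Type) where
  round : ℕ
  added : Finset (V × V)
  iter : ℕ
  mem : V → PropMem V
  time : V → ℕ
  exited : V → Bool

/-- Beginning of a round on the digraph `E` together with the edges added so far. -/
def startRound (E : Finset (V × V)) (round : ℕ) (added : Finset (V × V)) (time : V → ℕ)
    (exited : V → Bool) : Config V where
  round := round
  added := added
  iter := 1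
  mem u := (initMem u (outNbrs (E ∪ added) u)).val
  time u := time u + if exited u then 0 else (initMem u (outNbrs (E ∪ added) u)).time
  exited := exited

/-- The initial state. -/
def initial (E : Finset (V × V)) : Config V :=
  startRound E 0 ∅ (fun _ => 0) (fun _ => false)

/-- Agent `u` performs the current iteration of edge propagation. -/
def Config.propagating (c : Config V) (u : V) : Bool :=
  !c.exited u && active c.iter (c.mem u)

/-- An arrival order: in round `r`, agent `u` receives messages from the senders `l` in the order
`order r u l`. -/
abbrev ArrivalOrder (V : Type) : Type := ℕ → V → List V → List V

/-- The computation of agent `u` in one iteration of edge propagation. -/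
def propagateAgent (E : Finset (V × V)) (order : ArrivalOrder V) (c : Config V) (u : V) :
    Timed (PropMem V) :=
  if c.propagating u then
    propagateBody (outNbrs (E ∪ c.added) u)
      ((order c.round u (inNbrs (E ∪ c.added) u)).map fun v =>
        if c.propagating v then (c.mem v).fresh else [])
      (c.mem u)
  else pure (c.mem u)

/-- One synchronous iteration of edge propagation. -/
def propagateStep (E : Finset (V × V)) (order : ArrivalOrder V) (c : Config V) : Config V :=
  { c with
    iter := c.iter + 1
    mem := fun u => (propagateAgent E order c u).val
    time := fun u => c.time u + (propagateAgent E order c u).time }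

/-- Second and third part of Phase 1 for agent `u`. -/
def phase1 (c : Config V) (u : V) : Timed (SCCTable V × Decision) :=
  if c.exited u then pure (⟨[], fun _ => 0, fun _ => false, fun _ => false⟩, Decision.exit)
  else classify u (c.mem u).known

/-- Phase 2 for agent `u`; the result is the set of agents to which `u` proposes. -/
def phase2 (c : Config V) (u : V) : Timed (List V) :=
  match (phase1 c u).val.2 with
  | Decision.phase2 => runPhase2 (phase1 c u).val.1
  | _ => pure []

/-- The messages sent to `u` in Phase 2. -/
def inbox3 (order : ArrivalOrder V) (c : Config V) (u : V) : List (V × List V) :=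
  (order c.round u ((Finset.univ.filter fun t => u ∈ (phase2 c t).val).sort (· ≤ ·))).map
    fun t => (t, (phase2 c t).val)

/-- Phase 3 for agent `u`. -/
def phase3 (order : ArrivalOrder V) (c : Config V) (u : V) : Timed (Option V × List (V × V)) :=
  match (phase1 c u).val.2 with
  | Decision.phase3 => runPhase3 u (inbox3 order c u)
  | _ => pure (none, [])

/-- The messages sent to `u` in Phase 3: each `s` that selected `u` sends the set of agents
that proposed to `s`. -/
def inbox4 (order : ArrivalOrder V) (c : Config V) (u : V) : List (V × List V) :=
  (order c.round u
    ((Finset.univ.filter fun s => (phase3 order c s).val.1 = some u).sort (· ≤ ·))).map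
    fun s => (s, (inbox3 order c s).map Prod.fst)

/-- Phase 4 for agent `u`, to which it comes from Phase 2. -/
def phase4 (order : ArrivalOrder V) (c : Config V) (u : V) : Timed (List (V × V)) :=
  match (phase1 c u).val.2 with
  | Decision.phase2 => runPhase4 u (inbox4 order c u)
  | _ => pure []

/-- The rest of a round, once edge propagation has ended for all agents, and the beginning of the
next round. -/
def finishRound (E : Finset (V × V)) (order : ArrivalOrder V) (c : Config V) : Config V :=
  startRound E (c.round + 1)
    (c.added ∪ Finset.univ.biUnion fun u =>
      ((phase3 order c u).val.2 ++ (phase4 order c u).val).toFinset)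
    (fun u => c.time u + (phase1 c u).time + (phase2 c u).time + (phase3 order c u).time
      + (phase4 order c u).time)
    (fun u => match (phase1 c u).val.2 with
      | Decision.exit => true
      | _ => false)

/-- One step of the network. Phases are synchronised: the later phases of a round begin when
edge propagation has ended for all agents. -/
def step (E : Finset (V × V)) (order : ArrivalOrder V) (c : Config V) : Config V :=
  if ∀ u, c.exited u = true then c
  else if ∃ u, c.propagating u = true then propagateStep E order c
  else finishRound E order c

/-- The state of the network after `n` steps of the distributed augmentation algorithm. -/
def run (E : Finset (V × V)) (order : ArrivalOrder V) (n : ℕ) : Config V :=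
  (step E order)^[n] (initial E)

end Network

end DigraphAugmentation

set_option linter.unusedSectionVars false

namespace DigraphAugmentation

/-! ### The step-counting monad -/

section TimedLemmas

variable {α β : Type}

/-! Everything rests on what an agent knows when edge propagation ends. After `k` iterations agent
`u` knows the edges whose tail has a walk of length at most `k` to `u`, and its fresh edges are
those whose tail is at distance exactly `k` (`PropInv.step`). If `k ≥ 1` and no tail is at distance
`k`, none is farther away (`walk_lt_of_no_fresh`), so an agent that stops before the others misses
nothing. In the end `u` knows exactly the edges whose tail reaches `u`. This determines, for every
ancestor `v` of `u`, the component of `v` and whether an edge enters or leaves it, because all edges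
involved have ancestors of `u` as tails. With the correctness of Tarjan's algorithm (`tarjan_spec`,
`computeSCCs_describes`), every decision of Phase 1 is right, and `R_t` is the set of source
representatives that reach `t` (`KnowsAncestors.decision`, `KnowsAncestors.mem_runPhase2`).

If there is one source component, every `R_t` has at most one element and Phase 3 never selects. If
there is one target component, every `P_s` has at most one element, so a selection in Phase 3 has no
alternative and Phase 4 never selects. Either way, and for every order of arrival, the new edges are
all pairs `(t, s)` of a target and a source representative with `s` reaching `t`
(`Informed.mem_newEdges`). No component is isolated, so each node reaches a target component and is
reached from a source component; uniqueness on one side makes every source reach every target. Hence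
any `u` gets to any `v` through some `t`, the new edge `(t, s)`, and `s`. There are as many new
edges as target components, or as source components, and every augmentation needs an edge out of
each of the former and into each of the latter (`isMinAugmentation_of_mem_iff`). The second round
sees a single isolated component: everybody exits and nothing is added.

For the time, let `n` and `m` be the numbers of nodes and edges. Here `n ≤ 2 * m`, and at most `n`
edges are added, so the second round runs on at most `3 * m` edges. An edge is sent at most once
along each outgoing link and received at most once along each incoming link, and there are at most
`m + 1` iterations, so propagation takes O(nm) steps. Tarjan's algorithm is linear by a potential
argument (`visit_time`, `tarjan_time`), and Phases 2 to 4 handle at most `n` lists of length at most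
`n` each. -/

@[simp] theorem Timed.val_pure (a : α) : (pure a : Timed α).val = a := rfl

@[simp] theorem Timed.time_pure (a : α) : (pure a : Timed α).time = 0 := rfl

@[simp] theorem Timed.val_bind (x : Timed α) (f : α → Timed β) :
    (x >>= f).val = (f x.val).val := rfl

@[simp] theorem Timed.time_bind (x : Timed α) (f : α → Timed β) :
    (x >>= f).time = x.time + (f x.val).time := rfl

@[simp] theorem val_charge (n : ℕ) : (charge n).val = () := rfl

@[simp] theorem time_charge (n : ℕ) : (charge n).time = n := rfl

theorem Timed.foldlM_val (f : α → β → Timed α) (l : List β) (a : α) :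
    (l.foldlM f a).val = l.foldl (fun a b => (f a b).val) a := by
  induction l generalizing a with
  | nil => rfl
  | cons b l ih => simp [List.foldlM_cons, ih]

/-- A potential argument for the time of a loop. -/
theorem Timed.foldlM_time_le (f : α → β → Timed α) (Φ : α → ℕ) (c : β → ℕ) (l : List β)
    (h : ∀ a, ∀ b ∈ l, (f a b).time + Φ a ≤ c b + Φ (f a b).val) (a : α) :
    (l.foldlM f a).time + Φ a ≤ (l.map c).sum + Φ (l.foldlM f a).val := by
  induction l generalizing a with
  | nil => simp
  | cons b l ih =>
    have h1 := h a b (by simp)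
    have h2 := ih (fun a b hb => h a b (by simp [hb])) (f a b).val
    simp only [List.foldlM_cons, Timed.time_bind, Timed.val_bind, List.map_cons, List.sum_cons]
    omega

theorem Timed.foldlM_time_le_sum (f : α → β → Timed α) (c : β → ℕ) (l : List β)
    (h : ∀ a, ∀ b ∈ l, (f a b).time ≤ c b) (a : α) :
    (l.foldlM f a).time ≤ (l.map c).sum := by
  simpa using Timed.foldlM_time_le f (fun _ => 0) c l (by simpa using h) a

end TimedLemmas

/-! ### Edge propagation -/

section Memory

variable {V : Type} [LinearOrder V]

/-- The three fields of a memory are consistent with each other. -/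
structure PropMem.Valid (m : PropMem V) : Prop where
  seen_iff : ∀ e, e ∈ m.seen ↔ e ∈ m.known
  nodup : m.known.Nodup

theorem absorb_val (m : PropMem V) (e : V × V) :
    (absorb m e).val = if e ∈ m.seen then m else
      ⟨insert e m.seen, e :: m.known, e :: m.fresh⟩ := by
  unfold absorb; split <;> simp [*]

/-- One step pays for the look-up; the other three occur exactly when `known` grows, and are charged
to that growth. -/
theorem absorb_time (m : PropMem V) (e : V × V) :
    (absorb m e).time + 3 * m.known.length = 1 + 3 * (absorb m e).val.known.length := by
  rw [absorb_val]; unfold absorb; split <;> simp [*]; omega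

/-- `m'` arises from `m` by recording the edges in `A`. -/
structure Absorbed (m m' : PropMem V) (A : Set (V × V)) : Prop where
  valid : m'.Valid
  known_iff : ∀ e, e ∈ m'.known ↔ e ∈ m.known ∨ e ∈ A
  fresh_iff : ∀ e, e ∈ m'.fresh ↔ e ∈ m.fresh ∨ e ∈ A ∧ e ∉ m.known
  -- Both lists grow by the same amount; stated without truncated subtraction.
  length_eq : m'.known.length + m.fresh.length = m.known.length + m'.fresh.length

theorem Absorbed.refl {m : PropMem V} (hm : m.Valid) : Absorbed m m ∅ :=
  ⟨hm, by simp, by simp, rfl⟩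

theorem Absorbed.trans {m₁ m₂ m₃ : PropMem V} {A B : Set (V × V)} (h : Absorbed m₁ m₂ A)
    (h' : Absorbed m₂ m₃ B) : Absorbed m₁ m₃ (A ∪ B) where
  valid := h'.valid
  known_iff e := by rw [h'.known_iff, h.known_iff, or_assoc]; rfl
  fresh_iff e := by
    rw [h'.fresh_iff, h.fresh_iff, h.known_iff, Set.mem_union]; tauto
  length_eq := by have := h.length_eq; have := h'.length_eq; omega

theorem absorbed_absorb {m : PropMem V} (hm : m.Valid) (e : V × V) :
    Absorbed m (absorb m e).val {e} := by
  rw [absorb_val]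
  split
  · next h =>
    have h' := (hm.seen_iff e).1 h
    refine ⟨hm, fun x => ?_, fun x => ?_, rfl⟩
    · simp only [Set.mem_singleton_iff]; constructor
      · exact Or.inl
      · rintro (h | rfl) <;> assumption
    · simp only [Set.mem_singleton_iff]; constructor
      · exact Or.inl
      · rintro (h | ⟨rfl, h''⟩)
        · assumption
        · exact absurd h' h''
  · next h =>
    have h' : e ∉ m.known := fun h'' => h ((hm.seen_iff e).2 h'')
    refine ⟨⟨fun x => by simp [hm.seen_iff], by simp [h', hm.nodup]⟩, fun x => ?_, fun x => ?_, ?_⟩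
    · simp [or_comm]
    · simp only [List.mem_cons, Set.mem_singleton_iff]; constructor
      · rintro (rfl | h) <;> tauto
      · rintro (h | ⟨rfl, h⟩) <;> tauto
    · simp; omega

theorem absorbed_foldlM {m : PropMem V} (hm : m.Valid) (l : List (V × V)) :
    Absorbed m (l.foldlM absorb m).val {e | e ∈ l} := by
  induction l generalizing m with
  | nil => simpa using Absorbed.refl hm
  | cons e l ih =>
    have h1 := absorbed_absorb hm e
    have h2 := h1.trans (ih h1.valid)
    have h3 : {x | x ∈ e :: l} = {e} ∪ {x | x ∈ l} := by ext x; simp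
    rw [List.foldlM_cons, Timed.val_bind, h3]
    exact h2

theorem foldlM_absorb_time (m : PropMem V) (l : List (V × V)) :
    (l.foldlM absorb m).time + 3 * m.known.length ≤
      l.length + 3 * (l.foldlM absorb m).val.known.length := by
  have := Timed.foldlM_time_le absorb (fun m => 3 * m.known.length) (fun _ => 1) l
    (fun a b _ => (absorb_time a b).le) m
  simpa using this

theorem absorbed_initMem (u : V) (out : List V) :
    Absorbed ⟨∅, [], []⟩ (initMem u out).val {e | e.1 = u ∧ e.2 ∈ out} := by
  unfold initMem
  convert absorbed_foldlM (m := ⟨∅, [], []⟩) ⟨by simp, by simp⟩ _ using 1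
  ext ⟨a, b⟩
  simp only [Set.mem_ofPred_eq, List.mem_map, Prod.mk.injEq]
  constructor
  · rintro ⟨rfl, h⟩; exact ⟨b, h, rfl, rfl⟩
  · rintro ⟨c, h, rfl, rfl⟩; exact ⟨rfl, h⟩

theorem initMem_time (u : V) (out : List V) :
    (initMem u out).time ≤ out.length + 3 * (initMem u out).val.known.length := by
  simpa [initMem] using foldlM_absorb_time (⟨∅, [], []⟩ : PropMem V) (out.map fun v => (u, v))

/-- The loop starts from an empty `fresh`, so afterwards `fresh` holds exactly what the inbox added
to `known`. -/
theorem absorbed_propagateBody (out : List V) (inbox : List (List (V × V))) {m : PropMem V}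
    (hm : m.Valid) :
    Absorbed { m with fresh := [] } (propagateBody out inbox m).val
      {e | ∃ msg ∈ inbox, e ∈ msg} := by
  have hm' : PropMem.Valid { m with fresh := [] } := ⟨hm.seen_iff, hm.nodup⟩
  simp only [propagateBody, Timed.val_bind]
  generalize { m with fresh := [] } = m₀ at hm'
  clear hm
  induction inbox generalizing m₀ with
  | nil => simpa using Absorbed.refl hm'
  | cons msg inbox ih =>
    simp only [List.foldlM_cons, Timed.val_bind]
    have h1 := absorbed_foldlM hm' msg
    have h3 : {e | ∃ a ∈ msg :: inbox, e ∈ a} = {e | e ∈ msg} ∪ {e | ∃ a ∈ inbox, e ∈ a} := by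
      ext x; simp
    rw [h3]
    exact h1.trans (ih _ h1.valid)

theorem propagateBody_time (out : List V) (inbox : List (List (V × V))) (m : PropMem V) :
    (propagateBody out inbox m).time + 3 * m.known.length ≤
      1 + out.length * (1 + m.fresh.length) + (inbox.map fun msg => 1 + msg.length).sum +
        3 * (propagateBody out inbox m).val.known.length := by
  have h := Timed.foldlM_time_le
    (fun m (msg : List (V × V)) => do charge 1; msg.foldlM absorb m)
    (fun m => 3 * m.known.length) (fun msg => 1 + msg.length) inbox
    (fun a b _ => by
      have := foldlM_absorb_time a b
      simp only [Timed.time_bind, Timed.val_bind, time_charge]; omega) { m with fresh := [] }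
  simp only [propagateBody, Timed.val_bind, Timed.time_bind, time_charge] at h ⊢
  omega

end Memory

/-! ### Tarjan's algorithm -/

section Tarjan

variable {V : Type} [LinearOrder V]

/-- Reachability in a digraph given by adjacency lists. -/
abbrev ListReach (succs : V → List V) (x y : V) : Prop :=
  Relation.ReflTransGen (fun a b => b ∈ succs a) x y

theorem popUntil_val (x : V) (l rest : List V) (num : V → Option (WithTop ℕ)) (comp : List V)
    (hx : x ∉ l) :
    (popUntil x (l ++ x :: rest) num comp).val =
      (x :: (l.reverse ++ comp), rest, fun v => if v ∈ l ∨ v = x then some ⊤ else num v) := by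
  induction l generalizing num comp with
  | nil =>
    simp only [popUntil, List.nil_append, if_true, Timed.val_bind, Timed.val_pure]
    congr 2
    funext v
    simp [Function.update_apply]
  | cons y l ih =>
    have hy : y ≠ x := fun h => hx (by simp [h])
    have hx' : x ∉ l := fun h => hx (by simp [h])
    simp only [popUntil, List.cons_append, if_neg hy, Timed.val_bind, ih _ _ hx']
    simp only [List.reverse_cons, List.append_assoc, List.singleton_append, List.mem_cons]
    congr 2
    funext v
    by_cases h1 : v = y
    · simp [h1]
    · simp [h1]

/-- The invariant of Tarjan's algorithm on the node set `N`, where `G` is the set of nodes whose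
visit is in progress. -/
structure TarjanInv (succs : V → List V) (N : Finset V) (G : Set V) (s : TarjanState V) :
    Prop where
  num_stack : ∀ v, v ∈ s.stack ↔ ∃ n : ℕ, s.num v = some (n : WithTop ℕ)
  num_lt : ∀ v (n : ℕ), s.num v = some (n : WithTop ℕ) → n < s.next
  num_comps : ∀ v, s.num v = some ⊤ ↔ ∃ c ∈ s.comps, v ∈ c
  nodup : (s.stack ++ s.comps.flatten).Nodup
  visited_mem : ∀ v, s.num v ≠ none → v ∈ N
  scc : ∀ c ∈ s.comps, ∀ x ∈ c, ∀ y, y ∈ c ↔ ListReach succs x y ∧ ListReach succs y x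
  comps_ne : ∀ c ∈ s.comps, c ≠ []
  -- A visited node outside `G` has been left by the search, so all its successors have been seen.
  black : ∀ v, s.num v ≠ none → v ∉ G → ∀ w ∈ succs v, s.num w ≠ none
  complete : ∀ v, s.num v = some ⊤ → ∀ w ∈ succs v, s.num w = some ⊤
  -- `older` and `toGray` replace the depth first search tree: paths run from older to younger stack
  -- nodes, and from each stack node back to a node in progress that is no younger. Together they
  -- make the popped segments strongly connected.
  older : ∀ v w (m n : ℕ), s.num v = some (m : WithTop ℕ) → s.num w = some (n : WithTop ℕ) →
    m ≤ n → ListReach succs v w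
  gray_stack : ∀ g ∈ G, g ∈ s.stack
  toGray : ∀ v (n : ℕ), s.num v = some (n : WithTop ℕ) →
    ∃ g ∈ G, ∃ m : ℕ, s.num g = some (m : WithTop ℕ) ∧ m ≤ n ∧ ListReach succs v g

/-- What holds after the nodes `xs` have been visited from the state `s`, with result `low` and new
state `s'`. -/
structure TarjanPost (succs : V → List V) (N : Finset V) (G : Set V) (s : TarjanState V)
    (xs : List V) (low : WithTop ℕ) (s' : TarjanState V) : Prop where
  inv : TarjanInv succs N G s'
  frame : ∀ v, s.num v ≠ none → s'.num v = s.num v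
  stack : ∃ l, s'.stack = l ++ s.stack
  next_le : s.next ≤ s'.next
  low_reach : low = ⊤ ∨ ∃ n : ℕ, low = n ∧ ∃ y, s'.num y = some (n : WithTop ℕ) ∧
    ∃ x ∈ xs, ListReach succs x y
  low_le : ∀ x ∈ xs, ∃ n, s'.num x = some n ∧ low ≤ n
  -- Every edge from a newly visited, still incomplete node back into the old stack is accounted for
  -- in `low`; this is what certifies a root.
  low_edge : ∀ y z (k n : ℕ), s.num y = none → s'.num y = some (k : WithTop ℕ) → z ∈ succs y →
    s.num z = some (n : WithTop ℕ) → low ≤ n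
  new_le : ∀ y (k : ℕ), s.num y = none → s'.num y = some (k : WithTop ℕ) → s.next ≤ k

theorem TarjanPost.nil {succs : V → List V} {N : Finset V} {G : Set V} {s : TarjanState V}
    (h : TarjanInv succs N G s) : TarjanPost succs N G s [] ⊤ s where
  inv := h
  frame _ _ := rfl
  stack := ⟨[], rfl⟩
  next_le := le_rfl
  low_reach := Or.inl rfl
  low_le := by simp
  low_edge y z k n h1 h2 := by simp [h1] at h2
  new_le y k h1 h2 := by simp [h1] at h2

theorem TarjanPost.append {succs : V → List V} {N : Finset V} {G : Set V}
    {s s' s'' : TarjanState V} {xs ys : List V} {low low' : WithTop ℕ}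
    (h : TarjanPost succs N G s xs low s') (h' : TarjanPost succs N G s' ys low' s'') :
    TarjanPost succs N G s (xs ++ ys) (min low low') s'' where
  inv := h'.inv
  frame v hv := by
    rw [h'.frame v (by rw [h.frame v hv]; exact hv), h.frame v hv]
  stack := by
    obtain ⟨l, hl⟩ := h.stack
    obtain ⟨l', hl'⟩ := h'.stack
    exact ⟨l' ++ l, by rw [hl', hl, List.append_assoc]⟩
  next_le := h.next_le.trans h'.next_le
  low_reach := by
    rcases le_total low low' with hle | hle
    · rw [min_eq_left hle]
      rcases h.low_reach with h1 | ⟨n, h1, y, h2, x, h3, h4⟩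
      · exact Or.inl h1
      · exact Or.inr ⟨n, h1, y, by rw [h'.frame y (by simp [h2]), h2], x, by simp [h3], h4⟩
    · rw [min_eq_right hle]
      rcases h'.low_reach with h1 | ⟨n, h1, y, h2, x, h3, h4⟩
      · exact Or.inl h1
      · exact Or.inr ⟨n, h1, y, h2, x, by simp [h3], h4⟩
  low_le x hx := by
    rcases List.mem_append.1 hx with hx | hx
    · obtain ⟨n, h1, h2⟩ := h.low_le x hx
      exact ⟨n, by rw [h'.frame x (by simp [h1]), h1], (min_le_left _ _).trans h2⟩
    · obtain ⟨n, h1, h2⟩ := h'.low_le x hx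
      exact ⟨n, h1, (min_le_right _ _).trans h2⟩
  low_edge y z k n hy hy' hz hzn := by
    by_cases h1 : s'.num y = none
    · exact (min_le_right _ _).trans
        (h'.low_edge y z k n h1 hy' hz (by rw [h.frame z (by simp [hzn]), hzn]))
    · exact (min_le_left _ _).trans
        (h.low_edge y z k n hy (by rw [← h'.frame y h1, hy']) hz hzn)
  new_le y k hy hy' := by
    by_cases h1 : s'.num y = none
    · exact h.next_le.trans (h'.new_le y k h1 hy')
    · exact h.new_le y k hy (by rw [← h'.frame y h1, hy'])

/-- The state in which the visit of `x` has begun. -/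
def TarjanState.push (s : TarjanState V) (x : V) : TarjanState V :=
  { s with next := s.next + 1
           num := Function.update s.num x (some (s.next : WithTop ℕ))
           stack := x :: s.stack }

theorem TarjanState.push_num_self (s : TarjanState V) (x : V) :
    (s.push x).num x = some (s.next : WithTop ℕ) := by simp [TarjanState.push]

theorem TarjanState.push_num_of_ne (s : TarjanState V) {x v : V} (h : v ≠ x) :
    (s.push x).num v = s.num v := by simp [TarjanState.push, h]

theorem TarjanInv.push {succs : V → List V} {N : Finset V} {G : Set V} {s : TarjanState V} {x : V}
    (h : TarjanInv succs N G s) (hx : s.num x = none) (hxN : x ∈ N)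
    (hG : ∀ g ∈ G, ListReach succs g x) : TarjanInv succs N (insert x G) (s.push x) where
  num_stack v := by
    by_cases hv : v = x
    · subst hv
      exact ⟨fun _ => ⟨_, s.push_num_self v⟩, fun _ => by simp [TarjanState.push]⟩
    · rw [s.push_num_of_ne hv, ← h.num_stack]
      simp [TarjanState.push, hv]
  num_lt v n hn := by
    by_cases hv : v = x
    · subst hv
      rw [s.push_num_self] at hn
      have : s.next = n := by simpa using hn
      simp [TarjanState.push, this]
    · rw [s.push_num_of_ne hv] at hn
      exact Nat.lt_succ_of_lt (h.num_lt v n hn)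
  num_comps v := by
    by_cases hv : v = x
    · subst hv
      rw [s.push_num_self]
      have := h.num_comps v
      simp only [hx] at this
      simp only [TarjanState.push]
      rw [← this]
      simp
    · rw [s.push_num_of_ne hv]; exact h.num_comps v
  nodup := by
    simp only [TarjanState.push, List.cons_append, List.nodup_cons]
    refine ⟨fun hm => ?_, h.nodup⟩
    rcases List.mem_append.1 hm with hm | hm
    · obtain ⟨n, hn⟩ := (h.num_stack x).1 hm
      simp [hx] at hn
    · obtain ⟨c, hc, hxc⟩ := List.mem_flatten.1 hm
      have := (h.num_comps x).2 ⟨c, hc, hxc⟩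
      simp [hx] at this
  visited_mem v hv := by
    by_cases h1 : v = x
    · exact h1 ▸ hxN
    · rw [s.push_num_of_ne h1] at hv; exact h.visited_mem v hv
  scc := h.scc
  comps_ne := h.comps_ne
  black v hv hvG w hw := by
    have h1 : v ≠ x := fun h1 => hvG (by simp [h1])
    rw [s.push_num_of_ne h1] at hv
    have h2 := h.black v hv (fun h2 => hvG (by simp [h2])) w hw
    by_cases h3 : w = x
    · exact absurd hx (h3 ▸ h2)
    · rwa [s.push_num_of_ne h3]
  complete v hv w hw := by
    have h1 : v ≠ x := by rintro rfl; simp [s.push_num_self] at hv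
    rw [s.push_num_of_ne h1] at hv
    have h2 := h.complete v hv w hw
    by_cases h3 : w = x
    · subst h3; simp [hx] at h2
    · rwa [s.push_num_of_ne h3]
  older v w m n hv hw hmn := by
    by_cases h1 : w = x
    · subst h1
      by_cases h2 : v = w
      · subst h2; exact .refl
      · rw [s.push_num_of_ne h2] at hv
        -- The new node is the youngest on the stack: `v` reaches some node in progress, and by `hG`
        -- that one reaches the new node.
        obtain ⟨g, hg, -, -, -, h3⟩ := h.toGray v m hv
        exact h3.trans (hG g hg)
    · rw [s.push_num_of_ne h1] at hw
      by_cases h2 : v = x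
      · subst h2
        rw [s.push_num_self] at hv
        have : s.next = m := by simpa using hv
        have := h.num_lt w n hw
        omega
      · rw [s.push_num_of_ne h2] at hv
        exact h.older v w m n hv hw hmn
  gray_stack g hg := by
    rcases hg with rfl | hg
    · simp [TarjanState.push]
    · simp [TarjanState.push, h.gray_stack g hg]
  toGray v n hv := by
    by_cases h1 : v = x
    · exact ⟨v, by simp [h1], n, hv, le_rfl, .refl⟩
    · rw [s.push_num_of_ne h1] at hv
      obtain ⟨g, hg, m, h2, h3, h4⟩ := h.toGray v n hv
      have h5 : g ≠ x := by rintro rfl; simp [hx] at h2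
      exact ⟨g, by simp [hg], m, by rw [s.push_num_of_ne h5, h2], h3, h4⟩

/-- The visit of a node that is not the root of its component. -/
theorem TarjanPost.of_lt {succs : V → List V} {N : Finset V} {G : Set V} {s s' : TarjanState V}
    {x : V} {low : WithTop ℕ} (hx : s.num x = none)
    (hp : TarjanPost succs N (insert x G) (s.push x) (succs x) low s')
    (hlow : low < (s.next : WithTop ℕ)) : TarjanPost succs N G s [x] low s' := by
  have hx' : s'.num x = some (s.next : WithTop ℕ) := by
    rw [hp.frame x (by simp [s.push_num_self]), s.push_num_self]
  have hne : ∀ v, s.num v ≠ none → v ≠ x := fun v hv h1 => hv (h1 ▸ hx)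
  have hframe : ∀ v, s.num v ≠ none → s'.num v = s.num v := fun v hv => by
    have h1 := s.push_num_of_ne (hne v hv)
    rw [hp.frame v (by rwa [h1]), h1]
  -- As `low` is finite, `x` reaches an incomplete `y` older than `x`. By `toGray`, `y` reaches a
  -- node `g` in progress that is no younger than `y`; hence `g ≠ x`.
  obtain ⟨n, rfl, y, hy, x', hx's, hx'y⟩ := hp.low_reach.resolve_left hlow.ne_top
  have hxy : ListReach succs x y := .head hx's hx'y
  have hn : n < s.next := by exact_mod_cast hlow
  obtain ⟨g, hgG, m, hgm, hmn, hyg⟩ := hp.inv.toGray y n hy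
  have hg : g ∈ G := by
    rcases hgG with rfl | hg
    · rw [hx'] at hgm
      have : s.next = m := by simpa using hgm
      omega
    · exact hg
  refine ⟨{ hp.inv with black := ?_, gray_stack := ?_, toGray := ?_ }, hframe, ?_, ?_, ?_, ?_, ?_,
    ?_⟩
  · intro v hv hvG w hw
    by_cases h1 : v = x
    · subst h1
      obtain ⟨k, hk, -⟩ := hp.low_le w hw
      simp [hk]
    · exact hp.inv.black v hv (by simp [h1, hvG]) w hw
  · exact fun g hg => hp.inv.gray_stack g (by simp [hg])
  · intro v k hv
    obtain ⟨g', hg', m', hm', hmk, hr⟩ := hp.inv.toGray v k hv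
    rcases hg' with rfl | hg'
    · rw [hx'] at hm'
      have : s.next = m' := by simpa using hm'
      -- What led back to `x`, which is no longer in progress, now leads on to `g`.
      exact ⟨g, hg, m, hgm, by omega, hr.trans (hxy.trans hyg)⟩
    · exact ⟨g', hg', m', hm', hmk, hr⟩
  · obtain ⟨l, hl⟩ := hp.stack
    exact ⟨l ++ [x], by simp [hl, TarjanState.push]⟩
  · exact (Nat.le_succ _).trans hp.next_le
  · exact Or.inr ⟨n, rfl, y, hy, x, by simp, hxy⟩
  · intro v hv
    rw [List.mem_singleton.1 hv]
    exact ⟨_, hx', hlow.le⟩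
  · intro v z k j hv hv' hz hj
    by_cases h1 : v = x
    · subst h1
      obtain ⟨i, hi, hle⟩ := hp.low_le z hz
      rw [hframe z (by simp [hj]), hj] at hi
      have : (j : WithTop ℕ) = i := by simpa using hi
      rwa [this]
    · exact hp.low_edge v z k j (by rw [s.push_num_of_ne h1, hv]) hv' hz
        (by rw [s.push_num_of_ne (hne z (by simp [hj])), hj])
  · intro v k hv hv'
    by_cases h1 : v = x
    · subst h1
      rw [hx'] at hv'
      have : s.next = k := by simpa using hv'
      omega
    · exact (Nat.le_succ _).trans (hp.new_le v k (by rw [s.push_num_of_ne h1, hv]) hv')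

theorem TarjanInv.complete_of_reach {succs : V → List V} {N : Finset V} {G : Set V}
    {s : TarjanState V} (h : TarjanInv succs N G s) {v w : V} (hv : s.num v = some ⊤)
    (hvw : ListReach succs v w) : s.num w = some ⊤ := by
  induction hvw with
  | refl => exact hv
  | tail _ hw ih => exact h.complete _ ih _ hw

/-- The visit of a node that is the root of its component. -/
theorem TarjanPost.of_le {succs : V → List V} {N : Finset V} {G : Set V} {s s' : TarjanState V}
    {x : V} {low : WithTop ℕ} {l : List V} (h : TarjanInv succs N G s) (hx : s.num x = none)
    (hG : ∀ g ∈ G, ListReach succs g x)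
    (hp : TarjanPost succs N (insert x G) (s.push x) (succs x) low s')
    (hl : s'.stack = l ++ x :: s.stack)
    (hlow : (s.next : WithTop ℕ) ≤ low) : TarjanPost succs N G s [x] ⊤
      { s' with num := fun v => if v ∈ l ∨ v = x then some ⊤ else s'.num v
                stack := s.stack
                comps := (x :: l.reverse) :: s'.comps } := by
  have hx' : s'.num x = some (s.next : WithTop ℕ) := by
    rw [hp.frame x (by simp [s.push_num_self]), s.push_num_self]
  have hne : ∀ v, s.num v ≠ none → v ≠ x := fun v hv h1 => hv (h1 ▸ hx)
  have hframe : ∀ v, s.num v ≠ none → s'.num v = s.num v := fun v hv => by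
    have h1 := s.push_num_of_ne (hne v hv)
    rw [hp.frame v (by rwa [h1]), h1]
  have hnd := hp.inv.nodup
  rw [hl] at hnd
  have hstack : ∀ v, v ∈ s.stack → s.num v ≠ none := fun v hv => by
    obtain ⟨n, hn⟩ := (h.num_stack v).1 hv
    simp [hn]
  have hnum : ∀ v, v ∈ l ∨ v = x → ∃ k : ℕ, s'.num v = some (k : WithTop ℕ) := fun v hv =>
    (hp.inv.num_stack v).1 (by rw [hl]; rcases hv with hv | hv <;> simp [hv])
  have hnew : ∀ v, v ∈ l ∨ v = x → s.num v = none := fun v hv => by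
    by_contra h1
    obtain ⟨k, hk⟩ := hnum v hv
    rw [hframe v h1] at hk
    have h2 := (h.num_stack v).2 ⟨k, hk⟩
    rcases hv with hv | rfl
    · have := (List.nodup_append.1 (List.nodup_append.1 hnd).1).2.2 v hv v (by simp [h2])
      exact this rfl
    · exact h1 hx
  have hlnum : ∀ v, v ∈ l ∨ v = x → ∃ k : ℕ, s'.num v = some (k : WithTop ℕ) ∧ s.next ≤ k := by
    intro v hv
    obtain ⟨k, hk⟩ := hnum v hv
    refine ⟨k, hk, ?_⟩
    by_cases h1 : v = x
    · subst h1
      rw [hx'] at hk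
      have : s.next = k := by simpa using hk
      omega
    · exact (Nat.le_succ _).trans
        (hp.new_le v k (by rw [s.push_num_of_ne h1, hnew v hv]) hk)
  have hsplit : ∀ v (k : ℕ), s'.num v = some (k : WithTop ℕ) → (v ∈ l ∨ v = x) ∨ v ∈ s.stack := by
    intro v k hk
    have := (hp.inv.num_stack v).2 ⟨k, hk⟩
    rw [hl] at this
    simpa [or_assoc] using this
  have hvis : ∀ v, s'.num v ≠ none → v ∉ G → ∀ w ∈ succs v, s'.num w ≠ none := by
    intro v hv hvG w hw
    by_cases h1 : v = x
    · subst h1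
      obtain ⟨k, hk, -⟩ := hp.low_le w hw
      simp [hk]
    · exact hp.inv.black v hv (by simp [h1, hvG]) w hw
  -- No edge goes from the segment to be popped to the rest of the stack: the number of its head
  -- would be below `s.next`, but also at least `low`.
  have hsucc : ∀ v, v ∈ l ∨ v = x → ∀ w ∈ succs v, (w ∈ l ∨ w = x) ∨ s'.num w = some ⊤ := by
    intro v hv w hw
    have h1 : s'.num w ≠ none := by
      obtain ⟨k, hk⟩ := hnum v hv
      refine hvis v (by simp [hk]) (fun hvG => ?_) w hw
      exact hstack v (h.gray_stack v hvG) (hnew v hv)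
    obtain ⟨n, hn⟩ := Option.ne_none_iff_exists'.1 h1
    rcases n with _ | n
    · exact Or.inr hn
    · refine Or.inl ((hsplit w n hn).resolve_right fun h2 => ?_)
      obtain ⟨j, hj⟩ := (h.num_stack w).1 h2
      have h3 : low ≤ j := by
        by_cases h4 : v = x
        · subst h4
          obtain ⟨i, hi, hle⟩ := hp.low_le w hw
          rw [hframe w (by simp [hj]), hj] at hi
          have : (j : WithTop ℕ) = i := by simpa using hi
          rwa [this]
        · obtain ⟨k, hk⟩ := hnum v hv
          exact hp.low_edge v w k j (by rw [s.push_num_of_ne h4, hnew v hv]) hk hw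
            (by rw [s.push_num_of_ne (hne w (by simp [hj])), hj])
      have h4 : s.next ≤ j := by exact_mod_cast hlow.trans h3
      exact absurd (h.num_lt w j hj) (by omega)
  -- `older` gives the path from `x`; `toGray` gives a path to `x` or to a node of `G`, and all of
  -- these reach `x`.
  have hreach : ∀ v, v ∈ l ∨ v = x → ListReach succs x v ∧ ListReach succs v x := by
    intro v hv
    obtain ⟨k, hk, hle⟩ := hlnum v hv
    refine ⟨hp.inv.older x v _ k hx' hk hle, ?_⟩
    obtain ⟨g, hg, -, -, -, h1⟩ := hp.inv.toGray v k hk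
    rcases hg with rfl | hg
    · exact h1
    · exact h1.trans (hG g hg)
  have hscc : ∀ v, v ∈ l ∨ v = x → ∀ y, (y ∈ l ∨ y = x) ↔
      ListReach succs v y ∧ ListReach succs y v := by
    intro v hv y
    constructor
    · intro hy
      exact ⟨(hreach v hv).2.trans (hreach y hy).1, (hreach y hy).2.trans (hreach v hv).1⟩
    · rintro ⟨h1, h2⟩
      -- A path that leaves the segment can only enter complete components, and from these no path
      -- returns.
      have h3 : (y ∈ l ∨ y = x) ∨ s'.num y = some ⊤ := by
        clear h2
        induction h1 with
        | refl => exact Or.inl hv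
        | tail _ hw ih =>
          rcases ih with ih | ih
          · exact hsucc _ ih _ hw
          · exact Or.inr (hp.inv.complete _ ih _ hw)
      refine h3.resolve_right fun h4 => ?_
      obtain ⟨k, hk⟩ := hnum v hv
      rw [hp.inv.complete_of_reach h4 h2] at hk
      simp at hk
  have hC : ∀ v, v ∈ x :: l.reverse ↔ v ∈ l ∨ v = x := fun v => by simp [or_comm]
  have hframe' : ∀ v, s.num v ≠ none →
      (if v ∈ l ∨ v = x then some ⊤ else s'.num v) = s.num v := fun v hv => by
    rw [if_neg fun h1 => hv (hnew v h1), hframe v hv]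
  -- All nodes pushed since `s` have been popped again, so the finite serial numbers are those of
  -- `s`, and the clauses about the stack are inherited from `h`.
  have hold : ∀ v (k : ℕ), (if v ∈ l ∨ v = x then some ⊤ else s'.num v) = some (k : WithTop ℕ) →
      s.num v = some (k : WithTop ℕ) := by
    intro v k hk
    by_cases h1 : v ∈ l ∨ v = x
    · simp [h1] at hk
    · have h2 := hk
      rw [if_neg h1] at h2
      rwa [hframe' v (hstack v ((hsplit v k h2).resolve_left h1))] at hk
  have hvis' : ∀ v, (if v ∈ l ∨ v = x then some ⊤ else s'.num v) ≠ none ↔ s'.num v ≠ none := by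
    intro v
    by_cases h1 : v ∈ l ∨ v = x
    · obtain ⟨k, hk⟩ := hnum v h1
      simp [h1, hk]
    · rw [if_neg h1]
  refine ⟨⟨?_, ?_, ?_, ?_, ?_, ?_, ?_, ?_, ?_, ?_, ?_, ?_⟩, hframe', ⟨[], rfl⟩, ?_, Or.inl rfl,
    ?_, ?_, ?_⟩
  · intro v
    refine (h.num_stack v).trans ⟨?_, ?_⟩
    · rintro ⟨n, hn⟩
      exact ⟨n, (hframe' v (by simp [hn])).trans hn⟩
    · rintro ⟨n, hn⟩
      exact ⟨n, hold v n hn⟩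
  · intro v n hn
    exact (h.num_lt v n (hold v n hn)).trans_le ((Nat.le_succ _).trans hp.next_le)
  · intro v
    simp only [List.mem_cons (a := _) (b := x :: l.reverse), exists_eq_or_imp, hC]
    by_cases h1 : v ∈ l ∨ v = x
    · rw [if_pos h1]; exact ⟨fun _ => Or.inl h1, fun _ => rfl⟩
    · rw [if_neg h1, hp.inv.num_comps]
      exact ⟨Or.inr, fun h2 => h2.resolve_left h1⟩
  · refine List.Perm.nodup ?_ hnd
    simp only [List.flatten_cons]
    have h1 : (l ++ x :: s.stack).Perm (s.stack ++ x :: l.reverse) := by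
      refine List.perm_middle.trans ?_
      refine (List.Perm.cons x ?_).trans List.perm_middle.symm
      exact List.perm_append_comm.trans ((List.reverse_perm l).symm.append_left _)
    rw [← List.append_assoc]
    exact h1.append_right _
  · intro v hv
    exact hp.inv.visited_mem v ((hvis' v).1 hv)
  · intro c hc
    rcases List.mem_cons.1 hc with rfl | hc
    · intro v hv y
      rw [hC] at hv ⊢
      exact hscc v hv y
    · exact hp.inv.scc c hc
  · intro c hc
    rcases List.mem_cons.1 hc with rfl | hc
    · simp
    · exact hp.inv.comps_ne c hc
  · intro v hv hvG w hw
    exact (hvis' w).2 (hvis v ((hvis' v).1 hv) hvG w hw)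
  · intro v hv w hw
    change (if v ∈ l ∨ v = x then some ⊤ else s'.num v) = some ⊤ at hv
    change (if w ∈ l ∨ w = x then some ⊤ else s'.num w) = some ⊤
    by_cases h1 : v ∈ l ∨ v = x
    · rcases hsucc v h1 w hw with h2 | h2
      · rw [if_pos h2]
      · rw [h2, ite_self]
    · rw [if_neg h1] at hv
      rw [hp.inv.complete v hv w hw, ite_self]
  · intro v w m n hv hw hmn
    exact h.older v w m n (hold v m hv) (hold w n hw) hmn
  · exact h.gray_stack
  · intro v n hv
    obtain ⟨g, hg, m, hm, hmn, hr⟩ := h.toGray v n (hold v n hv)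
    exact ⟨g, hg, m, (hframe' g (by simp [hm])).trans hm, hmn, hr⟩
  · exact (Nat.le_succ _).trans hp.next_le
  · intro v hv
    rw [List.mem_singleton.1 hv]
    exact ⟨⊤, by simp, le_rfl⟩
  · intro v z k n hv hv'
    exact absurd (hold v k hv') (by simp [hv])
  · intro v k hv hv'
    exact absurd (hold v k hv') (by simp [hv])

/-- Visit the node `x` unless it has been visited before. -/
def visitOnce (vis : V → TarjanState V → Timed (WithTop ℕ × TarjanState V)) (x : V)
    (s : TarjanState V) : Timed (WithTop ℕ × TarjanState V) :=
  match s.num x with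
  | some n => pure (n, s)
  | none => vis x s

theorem visitOnce_some (vis : V → TarjanState V → Timed (WithTop ℕ × TarjanState V)) (x : V)
    (s : TarjanState V) {n : WithTop ℕ} (h : s.num x = some n) :
    visitOnce vis x s = pure (n, s) := by simp [visitOnce, h]

theorem visitOnce_none (vis : V → TarjanState V → Timed (WithTop ℕ × TarjanState V)) (x : V)
    (s : TarjanState V) (h : s.num x = none) : visitOnce vis x s = vis x s := by
  simp [visitOnce, h]

theorem visitList_cons (vis : V → TarjanState V → Timed (WithTop ℕ × TarjanState V)) (x : V)
    (xs : List V) (s : TarjanState V) :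
    visitList vis (x :: xs) s = (do
      charge 2
      let p ← visitOnce vis x s
      let q ← visitList vis xs p.2
      charge 1
      pure (min p.1 q.1, q.2)) := rfl

/-- The end of the visit of the node `x` with serial number `n`. -/
def endVisit (x : V) (n : ℕ) (p : WithTop ℕ × TarjanState V) :
    Timed (WithTop ℕ × TarjanState V) :=
  if p.1 < (n : WithTop ℕ) then pure p
  else do
    let q ← popUntil x p.2.stack p.2.num []
    charge 1
    pure (⊤, { p.2 with num := q.2.2, stack := q.2.1, comps := q.1 :: p.2.comps })

theorem visit_succ (succs : V → List V) (d : ℕ) (x : V) (s : TarjanState V) :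
    visit succs (d + 1) x s = (do
      charge 4
      let p ← visitList (visit succs d) (succs x) (s.push x)
      charge 1
      endVisit x s.next p) := rfl

/-- Visiting single nodes correctly implies visiting lists of nodes correctly. -/
theorem visitList_post {succs : V → List V} {N : Finset V} {d : ℕ}
    {vis : V → TarjanState V → Timed (WithTop ℕ × TarjanState V)}
    (hvis : ∀ x s G, TarjanInv succs N G s → s.num x = none → x ∈ N →
      (∀ g ∈ G, ListReach succs g x) → (N.filter fun v => s.num v = none).card ≤ d →
      TarjanPost succs N G s [x] (vis x s).val.1 (vis x s).val.2)
    (xs : List V) (s : TarjanState V) (G : Set V) (h : TarjanInv succs N G s)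
    (hxs : ∀ x ∈ xs, x ∈ N ∧ ∀ g ∈ G, ListReach succs g x)
    (hd : (N.filter fun v => s.num v = none).card ≤ d) :
    TarjanPost succs N G s xs (visitList vis xs s).val.1 (visitList vis xs s).val.2 := by
  induction xs generalizing s with
  | nil => exact TarjanPost.nil h
  | cons x xs ih =>
    simp only [visitList_cons, Timed.val_bind, Timed.val_pure]
    generalize hp : visitOnce vis x s = p
    have h1 : TarjanPost succs N G s [x] p.val.1 p.val.2 := by
      rcases hn : s.num x with _ | n
      · rw [visitOnce_none vis x s hn] at hp
        subst hp
        exact hvis x s G h hn (hxs x (by simp)).1 (hxs x (by simp)).2 hd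
      · rw [visitOnce_some vis x s hn] at hp
        subst hp
        refine { TarjanPost.nil h with low_reach := ?_, low_le := ?_, low_edge := ?_ }
        · rcases n with _ | n
          · exact Or.inl rfl
          · exact Or.inr ⟨n, rfl, x, hn, x, by simp, .refl⟩
        · intro y hy
          rw [List.mem_singleton.1 hy]
          exact ⟨n, hn, le_rfl⟩
        · intro y z k n hy hy'
          simp [hy] at hy'
    refine h1.append (ih p.val.2 h1.inv (fun y hy => hxs y (by simp [hy])) ?_)
    refine (Finset.card_le_card fun v => ?_).trans hd
    simp only [Finset.mem_filter]
    rintro ⟨hv, hv'⟩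
    refine ⟨hv, ?_⟩
    by_contra h2
    exact h2 (h1.frame v h2 ▸ hv')

/-- Induction on the recursion bound `d`, which dominates the number of unvisited nodes. Starting a
visit uses up one of these, and the bound `0` cannot occur because `x` itself is unvisited. -/
theorem visit_post {succs : V → List V} {N : Finset V} (hN : ∀ v ∈ N, ∀ w ∈ succs v, w ∈ N)
    (d : ℕ) (x : V) (s : TarjanState V) (G : Set V) (h : TarjanInv succs N G s)
    (hx : s.num x = none) (hxN : x ∈ N) (hG : ∀ g ∈ G, ListReach succs g x)
    (hd : (N.filter fun v => s.num v = none).card ≤ d) :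
    TarjanPost succs N G s [x] (visit succs d x s).val.1 (visit succs d x s).val.2 := by
  induction d generalizing x s G with
  | zero =>
    have : x ∈ N.filter fun v => s.num v = none := by simp [hx, hxN]
    rw [Finset.card_eq_zero.1 (Nat.le_zero.1 hd)] at this
    simp at this
  | succ d ih =>
    have h1 := h.push hx hxN hG
    have h2 : (N.filter fun v => (s.push x).num v = none).card ≤ d := by
      have h3 : (N.filter fun v => (s.push x).num v = none) ⊂
          N.filter fun v => s.num v = none := by
        refine (Finset.ssubset_iff_of_subset fun v => ?_).2 ⟨x, by simp [hx, hxN], ?_⟩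
        · simp only [Finset.mem_filter]
          rintro ⟨hv, hv'⟩
          have hvx : v ≠ x := by rintro rfl; simp [s.push_num_self] at hv'
          exact ⟨hv, by rwa [s.push_num_of_ne hvx] at hv'⟩
        · simp [s.push_num_self]
      have := Finset.card_lt_card h3
      omega
    have hp := visitList_post ih (succs x) (s.push x) (insert x G) h1 (fun y hy => by
      refine ⟨hN x hxN y hy, fun g hg => ?_⟩
      rcases hg with rfl | hg
      · exact .single hy
      · exact (hG g hg).tail hy) h2
    rw [visit_succ]
    simp only [Timed.val_bind]
    generalize visitList (visit succs d) (succs x) (s.push x) = p at hp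
    unfold endVisit
    by_cases hlow : p.val.1 < (s.next : WithTop ℕ)
    · simp only [if_pos hlow, Timed.val_pure]
      exact hp.of_lt hx hlow
    · obtain ⟨l, hl⟩ := hp.stack
      have hl' : p.val.2.stack = l ++ x :: s.stack := hl
      have hxl : x ∉ l := fun hxl => by
        have := hp.inv.nodup
        rw [hl'] at this
        exact (List.nodup_append.1 (List.nodup_append.1 this).1).2.2 x hxl x (by simp) rfl
      simp only [if_neg hlow, Timed.val_pure, Timed.val_bind]
      rw [hl', popUntil_val x l s.stack p.val.2.num [] hxl]
      simp only [List.append_nil]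
      exact hp.of_le h hx hG hl' (not_lt.1 hlow)

/-- Tarjan's algorithm is correct. -/
theorem tarjan_spec (g : LocalGraph V) (hnd : g.nodes.Nodup)
    (hg : ∀ v ∈ g.nodes, ∀ w ∈ g.succs v, w ∈ g.nodes) :
    (tarjan g).val.flatten.Nodup ∧ (∀ v, v ∈ (tarjan g).val.flatten ↔ v ∈ g.nodes) ∧
      (∀ c ∈ (tarjan g).val, c ≠ []) ∧
      ∀ c ∈ (tarjan g).val, ∀ x ∈ c, ∀ y,
        y ∈ c ↔ ListReach g.succs x y ∧ ListReach g.succs y x := by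
  have h0 : TarjanInv g.succs g.nodes.toFinset ∅ ⟨0, fun _ => none, [], []⟩ := by
    constructor <;> simp
  have hp := visitList_post (visit_post (N := g.nodes.toFinset) (succs := g.succs)
    (by simpa using hg) g.nodes.length) g.nodes _ ∅ h0 (by simp)
    (by simp [List.toFinset_card_of_nodup hnd])
  simp only [tarjan, Timed.val_bind, Timed.val_pure]
  generalize visitList (visit g.succs g.nodes.length) g.nodes ⟨0, fun _ => none, [], []⟩ = p at hp
  -- At the end no node is in progress, so by `toGray` no incomplete node is left.
  have h1 : ∀ v n, p.val.2.num v = some n → n = ⊤ := by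
    intro v n hn
    rcases n with _ | n
    · rfl
    · obtain ⟨g, hg, -⟩ := hp.inv.toGray v n hn
      simp at hg
  refine ⟨(List.nodup_append.1 hp.inv.nodup).2.1, fun v => ⟨fun hv => ?_, fun hv => ?_⟩,
    hp.inv.comps_ne, hp.inv.scc⟩
  · obtain ⟨c, hc, hvc⟩ := List.mem_flatten.1 hv
    have := (hp.inv.num_comps v).2 ⟨c, hc, hvc⟩
    simpa using hp.inv.visited_mem v (by simp [this])
  · obtain ⟨n, hn, -⟩ := hp.low_le v hv
    rw [h1 v n hn] at hn
    exact List.mem_flatten.2 ((hp.inv.num_comps v).1 hn)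

/-! ### The time of Tarjan's algorithm -/

theorem popUntil_time (x : V) (l : List V) (num : V → Option (WithTop ℕ)) (comp : List V) :
    (popUntil x l num comp).time + 3 * (popUntil x l num comp).val.2.1.length = 3 * l.length := by
  induction l generalizing num comp with
  | nil => simp [popUntil]
  | cons y l ih =>
    by_cases h : y = x
    · simp [popUntil, h]; omega
    · have := ih (Function.update num y (some ⊤)) (y :: comp)
      simp only [popUntil, if_neg h, Timed.time_bind, Timed.val_bind, time_charge,
        List.length_cons]
      omega

theorem popUntil_num (x : V) (l : List V) (num : V → Option (WithTop ℕ)) (comp : List V) (v : V)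
    (hv : (popUntil x l num comp).val.2.2 v = none) : num v = none := by
  induction l generalizing num comp with
  | nil => simpa [popUntil] using hv
  | cons y l ih =>
    have h1 : ∀ v, Function.update num y (some ⊤) v = none → num v = none := fun v h1 => by
      by_cases h2 : v = y
      · simp [h2] at h1
      · simpa [h2] using h1
    by_cases h : y = x
    · simp only [popUntil, if_pos h, Timed.val_bind, Timed.val_pure] at hv
      exact h1 v hv
    · simp only [popUntil, if_neg h, Timed.val_bind] at hv
      exact h1 v (ih _ _ hv)

/-- A bound for the number of steps that remain in a state of Tarjan's algorithm. -/
def tarjanPotential (succs : V → List V) (N : Finset V) (s : TarjanState V) : ℕ :=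
  -- An unvisited node prepays 6 steps of its own visit, 3 for each successor, 1 for the end of the
  -- successor list, and 3 for being popped. A stack entry retains the last 3.
  (∑ v ∈ N with s.num v = none, (10 + 3 * (succs v).length)) + 3 * s.stack.length

theorem visitList_time {succs : V → List V} {N : Finset V}
    {vis : V → TarjanState V → Timed (WithTop ℕ × TarjanState V)}
    (hvis : ∀ x s, s.num x = none → x ∈ N →
      (vis x s).time + tarjanPotential succs N (vis x s).val.2 ≤ tarjanPotential succs N s)
    (xs : List V) (hxs : ∀ x ∈ xs, x ∈ N) (s : TarjanState V) :
    (visitList vis xs s).time + tarjanPotential succs N (visitList vis xs s).val.2 ≤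
      tarjanPotential succs N s + 3 * xs.length + 1 := by
  induction xs generalizing s with
  | nil => simp [visitList]; omega
  | cons x xs ih =>
    simp only [visitList_cons, Timed.val_bind, Timed.val_pure, Timed.time_bind, Timed.time_pure,
      time_charge]
    generalize hp : visitOnce vis x s = p
    have h1 : p.time + tarjanPotential succs N p.val.2 ≤ tarjanPotential succs N s := by
      rcases hn : s.num x with _ | n
      · rw [visitOnce_none vis x s hn] at hp
        subst hp
        exact hvis x s hn (hxs x (by simp))
      · rw [visitOnce_some vis x s hn] at hp
        subst hp
        simp
    have h2 := ih (fun y hy => hxs y (by simp [hy])) p.val.2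
    simp only [List.length_cons]
    omega

/-- Unlike for correctness, no lower bound on `d` is needed: a search whose recursion bound is
exhausted costs nothing. -/
theorem visit_time {succs : V → List V} {N : Finset V} (hN : ∀ v ∈ N, ∀ w ∈ succs v, w ∈ N)
    (d : ℕ) (x : V) (s : TarjanState V) (hx : s.num x = none) (hxN : x ∈ N) :
    (visit succs d x s).time + tarjanPotential succs N (visit succs d x s).val.2 ≤
      tarjanPotential succs N s := by
  induction d generalizing x s with
  | zero => simp [visit]
  | succ d ih =>
    have hp := visitList_time ih (succs x) (hN x hxN) (s.push x)
    have h1 : tarjanPotential succs N (s.push x) + 7 + 3 * (succs x).length ≤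
        tarjanPotential succs N s := by
      have h2 : (N.filter fun v => (s.push x).num v = none) =
          (N.filter fun v => s.num v = none).erase x := by
        ext v
        simp only [Finset.mem_filter, Finset.mem_erase]
        by_cases hv : v = x
        · subst hv; simp [s.push_num_self]
        · simp [s.push_num_of_ne hv, hv]
      have h3 := Finset.add_sum_erase (N.filter fun v => s.num v = none)
        (fun v => 10 + 3 * (succs v).length) (a := x) (by simp [hx, hxN])
      unfold tarjanPotential
      rw [h2]
      simp only [TarjanState.push, List.length_cons] at h3 ⊢
      omega
    simp only [visit_succ, Timed.val_bind, Timed.time_bind, time_charge]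
    generalize visitList (visit succs d) (succs x) (s.push x) = p at hp
    unfold endVisit
    by_cases hlow : p.val.1 < (s.next : WithTop ℕ)
    · simp only [if_pos hlow, Timed.time_pure, Timed.val_pure]
      omega
    · simp only [if_neg hlow, Timed.val_pure, Timed.val_bind, Timed.time_bind, Timed.time_pure,
        time_charge]
      have h2 := popUntil_time x p.val.2.stack p.val.2.num []
      have h3 := popUntil_num x p.val.2.stack p.val.2.num []
      generalize popUntil x p.val.2.stack p.val.2.num [] = q at h2 h3
      have h4 : (∑ v ∈ N with q.val.2.2 v = none, (10 + 3 * (succs v).length)) ≤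
          ∑ v ∈ N with p.val.2.num v = none, (10 + 3 * (succs v).length) := by
        refine Finset.sum_le_sum_of_subset fun v => ?_
        simp only [Finset.mem_filter]
        exact fun h => ⟨h.1, h3 v h.2⟩
      simp only [tarjanPotential] at hp h1 ⊢
      omega

theorem tarjan_time (g : LocalGraph V) (hnd : g.nodes.Nodup)
    (hg : ∀ v ∈ g.nodes, ∀ w ∈ g.succs v, w ∈ g.nodes) :
    (tarjan g).time ≤
      14 * g.nodes.length + 3 * (∑ v ∈ g.nodes.toFinset, (g.succs v).length) + 1 := by
  have hp := visitList_time (visit_time (N := g.nodes.toFinset) (succs := g.succs)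
    (by simpa using hg) g.nodes.length) g.nodes (by simp) ⟨0, fun _ => none, [], []⟩
  simp only [tarjan, Timed.time_bind, Timed.time_pure, time_charge]
  have h1 : tarjanPotential g.succs g.nodes.toFinset ⟨0, fun _ => none, [], []⟩ =
      10 * g.nodes.length + 3 * (∑ v ∈ g.nodes.toFinset, (g.succs v).length) := by
    simp [tarjanPotential, Finset.sum_add_distrib, Finset.mul_sum,
      List.toFinset_card_of_nodup hnd, mul_comm]
  omega

end Tarjan

/-! ### The digraph in the memory of an agent -/

section LocalGraph

variable {V : Type} [LinearOrder V]

theorem addNode_val (g : LocalGraph V) (v : V) :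
    (addNode g v).val = if v ∈ g.marked then g else
      { g with nodes := v :: g.nodes, marked := insert v g.marked } := by
  unfold addNode; split <;> simp [*]

theorem addNode_time (g : LocalGraph V) (v : V) : (addNode g v).time ≤ 3 := by
  unfold addNode; split <;> simp [*]

/-- The memory `g` represents the digraph with the nodes in `A` and the edges in `K`. -/
structure LocalGraph.Represents (g : LocalGraph V) (A : Set V) (K : List (V × V)) : Prop where
  marked_iff : ∀ v, v ∈ g.marked ↔ v ∈ g.nodes
  nodup : g.nodes.Nodup
  nodes_iff : ∀ v, v ∈ g.nodes ↔ v ∈ A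
  succs_iff : ∀ v w, w ∈ g.succs v ↔ (v, w) ∈ K
  sum_succs : ∀ N : Finset V, ∑ v ∈ N, (g.succs v).length ≤ K.length

theorem LocalGraph.Represents.addNode {g : LocalGraph V} {A : Set V} {K : List (V × V)}
    (h : g.Represents A K) (v : V) : (addNode g v).val.Represents (insert v A) K := by
  rw [addNode_val]
  split
  · next hv =>
    have : insert v A = A := Set.insert_eq_of_mem ((h.nodes_iff v).1 ((h.marked_iff v).1 hv))
    rwa [this]
  · next hv =>
    exact ⟨fun w => by simp [h.marked_iff], by simp [← h.marked_iff, hv, h.nodup],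
      fun w => by simp [h.nodes_iff], h.succs_iff, h.sum_succs⟩

theorem LocalGraph.Represents.addEdge {g : LocalGraph V} {A : Set V} {K : List (V × V)}
    (h : g.Represents A K) (e : V × V) :
    (addEdge g e).val.Represents (insert e.2 (insert e.1 A)) (e :: K) := by
  have h2 := (h.addNode e.1).addNode e.2
  simp only [DigraphAugmentation.addEdge, Timed.val_bind, Timed.val_pure]
  generalize (DigraphAugmentation.addNode (DigraphAugmentation.addNode g e.1).val e.2).val = g' at h2
  refine ⟨h2.marked_iff, h2.nodup, h2.nodes_iff, fun v w => ?_, fun N => ?_⟩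
  · by_cases hv : v = e.1
    · subst hv
      simp [h2.succs_iff, Prod.ext_iff]
    · simp [h2.succs_iff, Prod.ext_iff, hv]
  · have h3 : ∀ v, (Function.update g'.succs e.1 (e.2 :: g'.succs e.1) v).length =
        (g'.succs v).length + if v = e.1 then 1 else 0 := by
      intro v
      by_cases hv : v = e.1
      · subst hv; simp
      · simp [hv]
    have h4 := h2.sum_succs N
    simp only [h3, Finset.sum_add_distrib, List.length_cons, Finset.sum_ite_eq']
    split <;> omega

theorem addEdge_time (g : LocalGraph V) (e : V × V) : (addEdge g e).time ≤ 7 := by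
  have h1 := addNode_time g e.1
  have h2 := addNode_time (addNode g e.1).val e.2
  simp only [addEdge, Timed.time_bind, Timed.time_pure, time_charge]
  omega

/-- The reversal appears because the fold puts each edge in front; only membership and length of the
list matter later. -/
theorem buildGraph_represents (u : V) (K : List (V × V)) :
    (buildGraph u K).val.Represents {v | v = u ∨ ∃ e ∈ K, v = e.1 ∨ v = e.2} K.reverse := by
  have h0 : (⟨[], ∅, fun _ => []⟩ : LocalGraph V).Represents ∅ [] := by
    constructor <;> simp
  have h1 := h0.addNode u
  simp only [buildGraph, Timed.val_bind]
  generalize (addNode ⟨[], ∅, fun _ => []⟩ u).val = g at h1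
  have key : ∀ (K K' : List (V × V)) (A : Set V) (g : LocalGraph V), g.Represents A K' →
      (K.foldlM addEdge g).val.Represents {v | v ∈ A ∨ ∃ e ∈ K, v = e.1 ∨ v = e.2}
        (K.reverse ++ K') := by
    intro K
    induction K with
    | nil => intro K' A g h; simpa using h
    | cons e K ih =>
      intro K' A g h
      have h2 := ih _ _ _ (h.addEdge e)
      have h3 : {v | v ∈ insert e.2 (insert e.1 A) ∨ ∃ e ∈ K, v = e.1 ∨ v = e.2} =
          {v | v ∈ A ∨ ∃ e_1 ∈ e :: K, v = e_1.1 ∨ v = e_1.2} := by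
        ext v
        simp only [Set.mem_ofPred_eq, Set.mem_insert_iff, List.mem_cons, exists_eq_or_imp]
        generalize (∃ e ∈ K, v = e.1 ∨ v = e.2) = q
        tauto
      rw [h3] at h2
      simpa [List.foldlM_cons] using h2
  simpa using key K [] _ g h1

theorem buildGraph_time (u : V) (K : List (V × V)) :
    (buildGraph u K).time ≤ 3 + 7 * K.length := by
  have h1 := addNode_time (⟨[], ∅, fun _ => []⟩ : LocalGraph V) u
  have h2 := Timed.foldlM_time_le_sum addEdge (fun _ => 7) K (fun g e _ => addEdge_time g e)
    (addNode ⟨[], ∅, fun _ => []⟩ u).val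
  simp only [buildGraph, Timed.time_bind]
  simp at h2
  omega

end LocalGraph

/-! ### The table of components -/

section Table

variable {V : Type} [LinearOrder V]

/-- `u` and `v` reach each other along the edges in `K`. -/
def Mutual (K : V × V → Prop) (u v : V) : Prop :=
  Relation.ReflTransGen (fun a b => K (a, b)) u v ∧ Relation.ReflTransGen (fun a b => K (a, b)) v u

theorem Mutual.refl (K : V × V → Prop) (u : V) : Mutual K u u := ⟨.refl, .refl⟩

theorem Mutual.symm {K : V × V → Prop} {u v : V} (h : Mutual K u v) : Mutual K v u := ⟨h.2, h.1⟩

theorem Mutual.trans {K : V × V → Prop} {u v w : V} (h : Mutual K u v) (h' : Mutual K v w) :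
    Mutual K u w := ⟨h.1.trans h'.1, h'.2.trans h.2⟩

/-- Some edge leaves the component of `v`. -/
def LeavesComp (K : V × V → Prop) (v : V) : Prop :=
  ∃ e, K e ∧ Mutual K v e.1 ∧ ¬ Mutual K v e.2

/-- Some edge enters the component of `v`. -/
def EntersComp (K : V × V → Prop) (v : V) : Prop :=
  ∃ e, K e ∧ ¬ Mutual K v e.1 ∧ Mutual K v e.2

/-- The table `T` describes the components of the digraph with nodes `A` and edges `K`. -/
structure SCCTable.Describes (T : SCCTable V) (A : Set V) (K : V × V → Prop) : Prop where
  covers : ∀ v, v ∈ A ↔ ∃ p ∈ T.comps, v ∈ p.1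
  label_eq : ∀ p ∈ T.comps, ∀ v ∈ p.1, T.label v = p.2
  inj : ∀ p ∈ T.comps, ∀ q ∈ T.comps, p.2 = q.2 → p = q
  flatten_nodup : (T.comps.map Prod.fst).flatten.Nodup
  ne : ∀ p ∈ T.comps, p.1 ≠ []
  scc : ∀ p ∈ T.comps, ∀ v ∈ p.1, ∀ w, w ∈ p.1 ↔ Mutual K v w
  hasIn_iff : ∀ p ∈ T.comps, ∀ v ∈ p.1, T.hasIn p.2 = true ↔ EntersComp K v
  hasOut_iff : ∀ p ∈ T.comps, ∀ v ∈ p.1, T.hasOut p.2 = true ↔ LeavesComp K v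

theorem foldl_update (f : (V → ℕ)) (l : List V) (i : ℕ) (v : V) :
    l.foldl (fun f v => Function.update f v i) f v = if v ∈ l then i else f v := by
  induction l generalizing f with
  | nil => simp
  | cons w l ih =>
    rw [List.foldl_cons, ih]
    by_cases h1 : v ∈ l
    · simp [h1]
    · by_cases h2 : v = w
      · simp [h2]
      · simp [h1, h2]

theorem labelComp_val (f : V → ℕ) (p : List V × ℕ) (v : V) :
    (labelComp f p).val v = if v ∈ p.1 then p.2 else f v := by
  simp only [labelComp, Timed.val_bind, Timed.foldlM_val, Timed.val_pure]
  exact foldl_update f p.1 p.2 v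

theorem labelComp_time (f : V → ℕ) (p : List V × ℕ) : (labelComp f p).time ≤ 1 + p.1.length := by
  have := Timed.foldlM_time_le_sum (fun (l : V → ℕ) v => (do
    charge 1; pure (Function.update l v p.2) : Timed (V → ℕ))) (fun _ => 1) p.1 (by simp) f
  simp only [labelComp, Timed.time_bind, time_charge]
  simp only [List.map_const', List.sum_replicate, smul_eq_mul, mul_one] at this
  omega

/-- A later component overwrites the labels of an earlier one only on common nodes, and there are
none. Induction from the end of the list isolates the last write. -/
theorem foldlM_labelComp_val (ps : List (List V × ℕ))
    (h : ∀ p ∈ ps, ∀ q ∈ ps, ∀ v, v ∈ p.1 → v ∈ q.1 → p = q) (f : V → ℕ) :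
    ∀ p ∈ ps, ∀ v ∈ p.1, (ps.foldlM labelComp f).val v = p.2 := by
  rw [Timed.foldlM_val]
  induction ps using List.reverseRecOn with
  | nil => simp
  | append_singleton ps q ih =>
    intro p hp v hv
    rw [List.foldl_append, List.foldl_cons, List.foldl_nil, labelComp_val]
    split
    · next h1 => rw [h q (by simp) p hp v h1 hv]
    · next h1 =>
      rcases List.mem_append.1 hp with hp | hp
      · exact ih (fun p hp q hq => h p (by simp [hp]) q (by simp [hq])) p hp v hv
      · rw [List.mem_singleton.1 hp] at hv
        exact absurd hv h1

theorem markEdge_val (T : SCCTable V) (e : V × V) :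
    (markEdge T e).val = if T.label e.1 = T.label e.2 then T else
      { T with hasIn := Function.update T.hasIn (T.label e.2) true
               hasOut := Function.update T.hasOut (T.label e.1) true } := by
  unfold markEdge
  simp only [Timed.val_bind]
  split <;> simp

theorem markEdge_time (T : SCCTable V) (e : V × V) : (markEdge T e).time ≤ 5 := by
  unfold markEdge
  simp only [Timed.time_bind, time_charge]
  split <;> simp

theorem foldlM_markEdge_val (K : List (V × V)) (T : SCCTable V) :
    (K.foldlM markEdge T).val.comps = T.comps ∧ (K.foldlM markEdge T).val.label = T.label ∧
      (∀ i, (K.foldlM markEdge T).val.hasIn i = true ↔ T.hasIn i = true ∨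
        ∃ e ∈ K, T.label e.1 ≠ i ∧ T.label e.2 = i) ∧
      (∀ i, (K.foldlM markEdge T).val.hasOut i = true ↔ T.hasOut i = true ∨
        ∃ e ∈ K, T.label e.1 = i ∧ T.label e.2 ≠ i) := by
  rw [Timed.foldlM_val]
  induction K generalizing T with
  | nil => simp
  | cons e K ih =>
    rw [List.foldl_cons]
    obtain ⟨h1, h2, h3, h4⟩ := ih (markEdge T e).val
    have hl : (markEdge T e).val.label = T.label := by rw [markEdge_val]; split <;> rfl
    have hc : (markEdge T e).val.comps = T.comps := by rw [markEdge_val]; split <;> rfl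
    have hi : ∀ i, (markEdge T e).val.hasIn i = true ↔
        T.hasIn i = true ∨ T.label e.1 ≠ i ∧ T.label e.2 = i := by
      intro i
      rw [markEdge_val]
      split
      · next h => rw [h]; tauto
      · next h =>
        by_cases hi : T.label e.2 = i
        · subst hi; simp [h]
        · simp [Ne.symm hi, hi]
    have ho : ∀ i, (markEdge T e).val.hasOut i = true ↔
        T.hasOut i = true ∨ T.label e.1 = i ∧ T.label e.2 ≠ i := by
      intro i
      rw [markEdge_val]
      split
      · next h => rw [h]; tauto
      · next h =>
        by_cases hi : T.label e.1 = i
        · subst hi; simp [Ne.symm h]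
        · simp [Ne.symm hi, hi]
    refine ⟨h1.trans hc, h2.trans hl, fun i => ?_, fun i => ?_⟩
    · rw [h3, hi, hl]; simp [or_assoc]
    · rw [h4, ho, hl]; simp [or_assoc]

/-- Labels separate components because Tarjan's components are disjoint and numbered distinctly.
Comparing the labels of the two ends of an edge therefore tests whether the ends are in the same
component. -/
theorem computeSCCs_describes (u : V) (K : List (V × V)) :
    (computeSCCs u K).val.Describes {v | v = u ∨ ∃ e ∈ K, v = e.1 ∨ v = e.2} (fun e => e ∈ K) := by
  have hg := buildGraph_represents u K
  have hcl : ∀ v ∈ (buildGraph u K).val.nodes, ∀ w ∈ (buildGraph u K).val.succs v,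
      w ∈ (buildGraph u K).val.nodes := by
    intro v _ w hw
    rw [hg.succs_iff, List.mem_reverse] at hw
    rw [hg.nodes_iff]
    exact Or.inr ⟨_, hw, Or.inr rfl⟩
  obtain ⟨t1, t2, t3, t4⟩ := tarjan_spec _ hg.nodup hcl
  simp only [computeSCCs, Timed.val_bind]
  generalize (buildGraph u K).val = g at *
  generalize (tarjan g).val = comps at *
  have hreach : ∀ v w, ListReach g.succs v w ↔
      Relation.ReflTransGen (fun a b => (a, b) ∈ K) v w := by
    have : (fun a b => b ∈ g.succs a) = fun a b => (a, b) ∈ K := by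
      funext a b; simp [hg.succs_iff]
    intro v w
    rw [ListReach, this]
  have hmem : ∀ p ∈ comps.zipIdx, p.1 ∈ comps := fun p hp => List.fst_mem_of_mem_zipIdx hp
  have hfst : comps.zipIdx.map Prod.fst = comps := List.zipIdx_map_fst 0 comps
  have hsnd : (comps.zipIdx.map Prod.snd).Nodup := by
    rw [List.zipIdx_map_snd]; exact List.nodup_range'
  have hinj : ∀ p ∈ comps.zipIdx, ∀ q ∈ comps.zipIdx, p.2 = q.2 → p = q :=
    fun p hp q hq h => List.inj_on_of_nodup_map hsnd hp hq h
  have hdisj : ∀ p ∈ comps.zipIdx, ∀ q ∈ comps.zipIdx, ∀ v, v ∈ p.1 → v ∈ q.1 → p = q := by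
    intro p hp q hq v hvp hvq
    by_contra hpq
    have h1 := (List.nodup_flatten.1 t1).2
    rw [← hfst, List.pairwise_map] at h1
    have : Std.Symm (fun a b : List V × ℕ => a.1.Disjoint b.1) := ⟨fun _ _ h => h.symm⟩
    exact h1.forall hp hq hpq hvp hvq
  have hlab := foldlM_labelComp_val comps.zipIdx hdisj (fun _ => 0)
  generalize (comps.zipIdx.foldlM labelComp fun _ => 0).val = label at *
  obtain ⟨m1, m2, m3, m4⟩ := foldlM_markEdge_val K
    ⟨comps.zipIdx, label, fun _ => false, fun _ => false⟩
  have hcov : ∀ v, (v = u ∨ ∃ e ∈ K, v = e.1 ∨ v = e.2) ↔ ∃ p ∈ comps.zipIdx, v ∈ p.1 := by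
    intro v
    have h1 : (v = u ∨ ∃ e ∈ K, v = e.1 ∨ v = e.2) ↔ v ∈ comps.flatten := by
      rw [t2, hg.nodes_iff]; rfl
    rw [h1]
    nth_rw 1 [← hfst]
    simp only [List.mem_flatten, List.mem_map]
    constructor
    · rintro ⟨_, ⟨p, hp, rfl⟩, hv⟩; exact ⟨p, hp, hv⟩
    · rintro ⟨p, hp, hv⟩; exact ⟨_, ⟨p, hp, rfl⟩, hv⟩
  have hscc : ∀ p ∈ comps.zipIdx, ∀ v ∈ p.1, ∀ w, w ∈ p.1 ↔ Mutual (fun e => e ∈ K) v w := by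
    intro p hp v hv w
    rw [t4 p.1 (hmem p hp) v hv w, hreach, hreach]
    rfl
  -- Both ends of a known edge are nodes of the digraph, so the default label `0` is never
  -- consulted.
  have hlabel : ∀ p ∈ comps.zipIdx, ∀ v ∈ p.1, ∀ e ∈ K,
      (label e.1 = p.2 ↔ Mutual (fun e => e ∈ K) v e.1) ∧
        (label e.2 = p.2 ↔ Mutual (fun e => e ∈ K) v e.2) := by
    intro p hp v hv e he
    have key : ∀ w, (∃ q ∈ comps.zipIdx, w ∈ q.1) →
        (label w = p.2 ↔ Mutual (fun e => e ∈ K) v w) := by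
      rintro w ⟨q, hq, hw⟩
      rw [hlab q hq w hw, ← hscc p hp v hv]
      constructor
      · intro h; rwa [← hinj q hq p hp h]
      · intro h; rw [hdisj q hq p hp w hw h]
    exact ⟨key e.1 ((hcov _).1 (Or.inr ⟨e, he, Or.inl rfl⟩)),
      key e.2 ((hcov _).1 (Or.inr ⟨e, he, Or.inr rfl⟩))⟩
  constructor
  · intro v; rw [m1]; exact hcov v
  · rw [m1, m2]; exact hlab
  · rw [m1]; exact hinj
  · rw [m1, hfst]; exact t1
  · rw [m1]; exact fun p hp => t3 p.1 (hmem p hp)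
  · rw [m1]; exact hscc
  · rw [m1]
    intro p hp v hv
    rw [m3]
    simp only [Bool.false_eq_true, false_or, EntersComp]
    refine exists_congr fun e => and_congr_right fun he => ?_
    have := hlabel p hp v hv e he
    rw [Ne, this.1, this.2]
  · rw [m1]
    intro p hp v hv
    rw [m4]
    simp only [Bool.false_eq_true, false_or, LeavesComp]
    refine exists_congr fun e => and_congr_right fun he => ?_
    have := hlabel p hp v hv e he
    rw [Ne, this.1, this.2]

/-- Bounds the number of components by the number of nodes, since components are nonempty. -/
theorem length_le_length_flatten {α : Type} (L : List (List α)) (h : ∀ l ∈ L, l ≠ []) :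
    L.length ≤ L.flatten.length := by
  induction L with
  | nil => simp
  | cons l L ih =>
    have h1 := List.length_pos_iff.2 (h l (by simp))
    have h2 := ih fun l hl => h l (by simp [hl])
    simp only [List.length_cons, List.flatten_cons, List.length_append]
    omega

theorem computeSCCs_time [Fintype V] (u : V) (K : List (V × V)) :
    (computeSCCs u K).time ≤ 17 * Fintype.card V + 15 * K.length + 4 := by
  have hg := buildGraph_represents u K
  have hcl : ∀ v ∈ (buildGraph u K).val.nodes, ∀ w ∈ (buildGraph u K).val.succs v,
      w ∈ (buildGraph u K).val.nodes := by
    intro v _ w hw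
    rw [hg.succs_iff, List.mem_reverse] at hw
    rw [hg.nodes_iff]
    exact Or.inr ⟨_, hw, Or.inr rfl⟩
  obtain ⟨t1, t2, t3, t4⟩ := tarjan_spec _ hg.nodup hcl
  have h1 := buildGraph_time u K
  have h2 := tarjan_time _ hg.nodup hcl
  simp only [computeSCCs, Timed.time_bind, time_charge]
  generalize (buildGraph u K).val = g at *
  have h3 := hg.sum_succs g.nodes.toFinset
  have h4 := hg.nodup.length_le_card
  generalize (tarjan g).val = comps at *
  have h5 := t1.length_le_card
  have h6 := length_le_length_flatten comps t3
  have h7 := Timed.foldlM_time_le_sum labelComp (fun p => 1 + p.1.length) comps.zipIdx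
    (fun f p _ => labelComp_time f p) (fun _ => 0)
  have h8 : (comps.zipIdx.map fun p => 1 + p.1.length).sum = comps.length + comps.flatten.length := by
    have : comps.zipIdx.map (fun p => 1 + p.1.length) =
        (comps.zipIdx.map Prod.fst).map (fun l => 1 + l.length) := by rw [List.map_map]; rfl
    rw [this, List.zipIdx_map_fst, List.length_flatten, List.sum_map_add]
    simp
  have h9 := Timed.foldlM_time_le_sum markEdge (fun _ => 5) K (fun T e _ => markEdge_time T e)
    ⟨comps.zipIdx, (comps.zipIdx.foldlM labelComp fun _ => 0).val, fun _ => false, fun _ => false⟩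
  simp only [List.map_const', List.sum_replicate, smul_eq_mul] at h9
  rw [List.length_reverse] at h3
  omega

theorem SCCTable.Describes.flatten_length_le [Fintype V] {T : SCCTable V} {A : Set V}
    {K : V × V → Prop} (h : T.Describes A K) :
    (T.comps.map Prod.fst).flatten.length ≤ Fintype.card V :=
  h.flatten_nodup.length_le_card

theorem SCCTable.Describes.comps_length_le [Fintype V] {T : SCCTable V} {A : Set V}
    {K : V × V → Prop} (h : T.Describes A K) : T.comps.length ≤ Fintype.card V := by
  have h1 := length_le_length_flatten (T.comps.map Prod.fst) (fun l hl => by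
    obtain ⟨p, hp, rfl⟩ := List.mem_map.1 hl
    exact h.ne p hp)
  rw [List.length_map] at h1
  exact h1.trans h.flatten_length_le

theorem SCCTable.Describes.length_le [Fintype V] {T : SCCTable V} {A : Set V}
    {K : V × V → Prop} (h : T.Describes A K) {p : List V × ℕ} (hp : p ∈ T.comps) :
    p.1.length ≤ Fintype.card V :=
  ((List.nodup_flatten.1 h.flatten_nodup).1 p.1 (List.mem_map_of_mem hp)).length_le_card

/-! ### Searches in the table, the classification, and Phase 2 for a single agent -/

theorem findComp_val {ps : List (List V × ℕ)} (h : ∀ p ∈ ps, ∀ q ∈ ps, p.2 = q.2 → p = q)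
    {p : List V × ℕ} (hp : p ∈ ps) : (findComp p.2 ps).val = p.1 := by
  induction ps with
  | nil => simp at hp
  | cons q ps ih =>
    simp only [findComp, Timed.val_bind]
    split
    · next h1 => rw [Timed.val_pure, h q (by simp) p hp h1]
    · next h1 =>
      refine ih (fun p hp q hq => h p (by simp [hp]) q (by simp [hq]))
        ((List.mem_cons.1 hp).resolve_left ?_)
      rintro rfl
      exact h1 rfl

theorem findComp_time (i : ℕ) (ps : List (List V × ℕ)) : (findComp i ps).time ≤ ps.length := by
  induction ps with
  | nil => simp [findComp]
  | cons q ps ih =>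
    simp only [findComp, Timed.time_bind, time_charge, List.length_cons]
    split
    · simp
    · omega

theorem lowest_val (l : List V) (v : V) :
    (lowest l).val = some v ↔ v ∈ l ∧ ∀ w ∈ l, v ≤ w := by
  induction l generalizing v with
  | nil => simp [lowest]
  | cons a l ih =>
    simp only [lowest, Timed.val_bind]
    rcases h : (lowest l).val with _ | m
    · have hl : l = [] := by
        rcases l with _ | ⟨b, l⟩
        · rfl
        · simp only [lowest, Timed.val_bind] at h
          rcases h' : (lowest l).val with _ | m <;> simp [h'] at h
      subst hl
      simp only [Timed.val_pure, Option.some.injEq, List.mem_cons, List.not_mem_nil, or_false,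
        forall_eq]
      exact ⟨by rintro rfl; simp, fun h => h.1.symm⟩
    · obtain ⟨h1, h2⟩ := (ih m).1 h
      simp only [Timed.val_pure, Option.some.injEq, List.mem_cons, forall_eq_or_imp]
      constructor
      · rintro rfl
        refine ⟨?_, min_le_left _ _, fun w hw => (min_le_right _ _).trans (h2 w hw)⟩
        rcases min_choice a m with h3 | h3 <;> rw [h3]
        · exact Or.inl rfl
        · exact Or.inr h1
      · rintro ⟨h3, h4, h5⟩
        apply le_antisymm
        · rcases h3 with rfl | h3
          · exact min_le_left _ _
          · exact (min_le_right _ _).trans (h2 v h3)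
        · exact le_min h4 (h5 m h1)

theorem lowest_time (l : List V) : (lowest l).time = l.length := by
  induction l with
  | nil => simp [lowest]
  | cons a l ih =>
    simp only [lowest, Timed.time_bind, time_charge, ih, List.length_cons]
    rcases (lowest l).val with _ | m <;> simp <;> omega

/-- `u` has the lowest ID of its component. -/
def IsRep (K : V × V → Prop) (u : V) : Prop :=
  ∀ v, Mutual K u v → u ≤ v

theorem SCCTable.Describes.lowest_iff {T : SCCTable V} {A : Set V} {K : V × V → Prop}
    (h : T.Describes A K) {p : List V × ℕ} (hp : p ∈ T.comps) (v : V) :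
    (lowest p.1).val = some v ↔ v ∈ p.1 ∧ IsRep K v := by
  rw [lowest_val]
  refine and_congr_right fun hv => forall_congr' fun w => ?_
  rw [h.scc p hp v hv]

theorem classify_table (u : V) (K : List (V × V)) :
    (classify u K).val.1 = (computeSCCs u K).val := by
  simp only [classify, Timed.val_bind]
  split <;> rfl

theorem classify_decision (u : V) (K : List (V × V)) :
    ((classify u K).val.2 = Decision.exit ↔
      ¬ EntersComp (fun e => e ∈ K) u ∧ ¬ LeavesComp (fun e => e ∈ K) u) ∧
    ((classify u K).val.2 = Decision.phase3 ↔
      ¬ EntersComp (fun e => e ∈ K) u ∧ LeavesComp (fun e => e ∈ K) u ∧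
        IsRep (fun e => e ∈ K) u) ∧
    ((classify u K).val.2 = Decision.phase2 ↔
      EntersComp (fun e => e ∈ K) u ∧ ¬ LeavesComp (fun e => e ∈ K) u ∧
        IsRep (fun e => e ∈ K) u) := by
  have h := computeSCCs_describes u K
  obtain ⟨p, hp, hu⟩ := (h.covers u).1 (Or.inl rfl)
  have h1 := h.label_eq p hp u hu
  have h2 := findComp_val h.inj hp
  have h3 := h.lowest_iff hp u
  have h4 := h.hasIn_iff p hp u hu
  have h5 := h.hasOut_iff p hp u hu
  simp only [classify, Timed.val_bind, h1, h2]
  by_cases h6 : (lowest p.1).val = some u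
  · have h7 := (h3.1 h6).2
    rw [← h4, ← h5]
    cases (computeSCCs u K).val.hasIn p.2 <;> cases (computeSCCs u K).val.hasOut p.2 <;>
      simp [h6, h7]
  · have h7 : ¬ IsRep (fun e => e ∈ K) u := fun h7 => h6 (h3.2 ⟨hu, h7⟩)
    rw [← h4, ← h5]
    cases (computeSCCs u K).val.hasIn p.2 <;> cases (computeSCCs u K).val.hasOut p.2 <;>
      simp [h6, h7]

theorem classify_time [Fintype V] (u : V) (K : List (V × V)) :
    (classify u K).time ≤ 19 * Fintype.card V + 15 * K.length + 11 := by
  have h := computeSCCs_describes u K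
  obtain ⟨p, hp, hu⟩ := (h.covers u).1 (Or.inl rfl)
  have h1 := h.label_eq p hp u hu
  have h2 := findComp_val h.inj hp
  have h3 := h.comps_length_le
  have h4 := h.length_le hp
  have h5 := computeSCCs_time u K
  have h6 := findComp_time p.2 (computeSCCs u K).val.comps
  simp only [classify, Timed.time_bind, h1, h2, lowest_time, time_charge]
  split <;> simp only [Timed.time_pure] <;> omega

/-- One step of the loop of Phase 2. -/
def collectRep (T : SCCTable V) (R : List V) (p : List V × ℕ) : Timed (List V) := do
  charge 3
  if T.hasIn p.2 = false ∧ T.hasOut p.2 = true then do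
    let m ← lowest p.1
    charge 1
    pure (m.toList ++ R)
  else pure R

theorem collectRep_val (T : SCCTable V) (R : List V) (p : List V × ℕ) :
    (collectRep T R p).val = if T.hasIn p.2 = false ∧ T.hasOut p.2 = true then
      (lowest p.1).val.toList ++ R else R := by
  unfold collectRep
  simp only [Timed.val_bind]
  split <;> simp

theorem collectRep_time (T : SCCTable V) (R : List V) (p : List V × ℕ) :
    (collectRep T R p).time ≤ 4 + p.1.length := by
  unfold collectRep
  simp only [Timed.time_bind, time_charge]
  split
  · simp [lowest_time]; omega
  · simp; omega

/-- Representatives of different components differ because the components are disjoint; so the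
collected list has no repetitions. -/
theorem foldlM_collectRep (T : SCCTable V) (ps : List (List V × ℕ)) (R : List V) :
    (∀ r, r ∈ (ps.foldlM (collectRep T) R).val ↔ r ∈ R ∨ ∃ p ∈ ps,
      (T.hasIn p.2 = false ∧ T.hasOut p.2 = true) ∧ (lowest p.1).val = some r) ∧
    (ps.foldlM (collectRep T) R).val.length ≤ R.length + ps.length ∧
    ((ps.map Prod.fst).flatten.Nodup → R.Nodup → (∀ r ∈ R, r ∉ (ps.map Prod.fst).flatten) →
      (ps.foldlM (collectRep T) R).val.Nodup) := by
  rw [Timed.foldlM_val]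
  induction ps generalizing R with
  | nil => simp
  | cons p ps ih =>
    rw [List.foldl_cons]
    obtain ⟨h1, h2, h3⟩ := ih (collectRep T R p).val
    have hm : ∀ r, r ∈ (collectRep T R p).val ↔ r ∈ R ∨
        (T.hasIn p.2 = false ∧ T.hasOut p.2 = true) ∧ (lowest p.1).val = some r := by
      intro r
      rw [collectRep_val]
      split
      · next h => simp [h, or_comm]
      · next h => simp only [h, false_and, or_false]
    refine ⟨fun r => ?_, ?_, fun hnd hR hdis => ?_⟩
    · rw [h1, hm]; simp [or_assoc]
    · have : (collectRep T R p).val.length ≤ R.length + 1 := by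
        rw [collectRep_val]
        split
        · rcases (lowest p.1).val with _ | m <;> simp
        · simp
      simp only [List.length_cons]
      omega
    · simp only [List.map_cons, List.flatten_cons, List.mem_append, not_or] at hnd hdis
      obtain ⟨n1, n2, n3⟩ := List.nodup_append.1 hnd
      refine h3 n2 ?_ ?_
      · rw [collectRep_val]
        split
        · rcases h4 : (lowest p.1).val with _ | m
          · simpa
          · simp only [Option.toList_some, List.cons_append, List.nil_append, List.nodup_cons]
            exact ⟨fun hmR => (hdis m hmR).1 ((lowest_val _ _).1 h4).1, hR⟩
        · exact hR
      · intro r hr hr'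
        rcases (hm r).1 hr with hr | ⟨-, hr⟩
        · exact (hdis r hr).2 hr'
        · exact n3 r ((lowest_val _ _).1 hr).1 r hr' rfl

theorem runPhase2_spec [Fintype V] {T : SCCTable V} {A : Set V} {K : V × V → Prop}
    (h : T.Describes A K) :
    (∀ r, r ∈ (runPhase2 T).val ↔ r ∈ A ∧ ¬ EntersComp K r ∧ LeavesComp K r ∧ IsRep K r) ∧
    (runPhase2 T).val.Nodup ∧
    (runPhase2 T).time ≤ 5 * Fintype.card V + Fintype.card V * (1 + Fintype.card V) := by
  obtain ⟨h1, h2, h3⟩ := foldlM_collectRep T T.comps []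
  have hval : (runPhase2 T).val = (T.comps.foldlM (collectRep T) []).val := rfl
  have htime : (runPhase2 T).time = (T.comps.foldlM (collectRep T) []).time +
      ((runPhase2 T).val.length * (1 + (runPhase2 T).val.length) + 0) := rfl
  rw [← hval] at h1 h2 h3
  refine ⟨fun r => ?_, h3 h.flatten_nodup (by simp) (by simp), ?_⟩
  · rw [h1]
    simp only [List.not_mem_nil, false_or]
    constructor
    · rintro ⟨p, hp, ⟨h4, h5⟩, h6⟩
      obtain ⟨h7, h8⟩ := (h.lowest_iff hp r).1 h6
      refine ⟨(h.covers r).2 ⟨p, hp, h7⟩, ?_, (h.hasOut_iff p hp r h7).1 h5, h8⟩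
      rw [← h.hasIn_iff p hp r h7, h4]
      simp
    · rintro ⟨hr, h4, h5, h6⟩
      obtain ⟨p, hp, h7⟩ := (h.covers r).1 hr
      rw [← h.hasIn_iff p hp r h7, Bool.not_eq_true] at h4
      exact ⟨p, hp, ⟨h4, (h.hasOut_iff p hp r h7).2 h5⟩, (h.lowest_iff hp r).2 ⟨h7, h6⟩⟩
  · have h4 := h.comps_length_le
    have h5 := h.flatten_length_le
    have h6 := Timed.foldlM_time_le_sum (collectRep T) (fun p => 4 + p.1.length) T.comps
      (fun R p _ => collectRep_time T R p) []
    have h7 : (T.comps.map fun p => 4 + p.1.length).sum =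
        4 * T.comps.length + (T.comps.map Prod.fst).flatten.length := by
      rw [List.length_flatten]
      generalize T.comps = ps
      induction ps with
      | nil => simp
      | cons p ps ih =>
        simp only [List.map_cons, List.sum_cons, List.length_cons] at ih ⊢
        omega
    have h8 : (runPhase2 T).val.length ≤ Fintype.card V := by simpa using h2.trans (by simpa using h4)
    have h9 := Nat.mul_le_mul h8 (Nat.add_le_add_left h8 1)
    rw [htime]
    omega

end Table

/-! ### Knowledge of an agent about its ancestors -/

section Knowledge

variable {V : Type} [LinearOrder V]

/-- `u` is the representative of a source component. -/
def SourceRep (E : Finset (V × V)) (u : V) : Prop :=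
  ¬ EntersComp (fun e => e ∈ E) u ∧ LeavesComp (fun e => e ∈ E) u ∧ IsRep (fun e => e ∈ E) u

/-- `u` is the representative of a target component. -/
def TargetRep (E : Finset (V × V)) (u : V) : Prop :=
  EntersComp (fun e => e ∈ E) u ∧ ¬ LeavesComp (fun e => e ∈ E) u ∧ IsRep (fun e => e ∈ E) u

/-- The list `K` consists of the edges from which `u` can be reached. -/
def KnowsAncestors (E : Finset (V × V)) (u : V) (K : List (V × V)) : Prop :=
  ∀ e, e ∈ K ↔ e ∈ E ∧ Reaches E e.1 u

/-- Every tail on a walk that ends in an ancestor of `u` is itself an ancestor of `u`, so the whole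
walk is known. -/
theorem KnowsAncestors.reaches {E : Finset (V × V)} {u : V} {K : List (V × V)}
    (h : KnowsAncestors E u K) {v w : V} (hw : Reaches E w u) (hvw : Reaches E v w) :
    Relation.ReflTransGen (fun a b => (a, b) ∈ K) v w := by
  induction hvw using Relation.ReflTransGen.head_induction_on with
  | refl => exact .refl
  | head hac hcw ih => exact .head ((h _).2 ⟨hac, .head hac (hcw.trans hw)⟩) ih

theorem KnowsAncestors.reaches_of {E : Finset (V × V)} {u : V} {K : List (V × V)}
    (h : KnowsAncestors E u K) {v w : V}
    (hvw : Relation.ReflTransGen (fun a b => (a, b) ∈ K) v w) : Reaches E v w :=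
  Relation.ReflTransGen.mono (fun _ _ hab => ((h _).1 hab).1) _ _ hvw

theorem KnowsAncestors.mutual_iff {E : Finset (V × V)} {u : V} {K : List (V × V)}
    (h : KnowsAncestors E u K) {v : V} (hv : Reaches E v u) (w : V) :
    Mutual (fun e => e ∈ K) v w ↔ Mutual (fun e => e ∈ E) v w :=
  ⟨fun h1 => ⟨h.reaches_of h1.1, h.reaches_of h1.2⟩,
    fun h1 => ⟨h.reaches (h1.2.trans hv) h1.1, h.reaches hv h1.2⟩⟩

theorem KnowsAncestors.enters_iff {E : Finset (V × V)} {u : V} {K : List (V × V)}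
    (h : KnowsAncestors E u K) {v : V} (hv : Reaches E v u) :
    EntersComp (fun e => e ∈ K) v ↔ EntersComp (fun e => e ∈ E) v := by
  unfold EntersComp
  simp only [h.mutual_iff hv]
  refine exists_congr fun e => ⟨fun h1 => ⟨((h e).1 h1.1).1, h1.2⟩, fun h1 => ⟨?_, h1.2⟩⟩
  exact (h e).2 ⟨h1.1, (Relation.ReflTransGen.single h1.1).trans (h1.2.2.2.trans hv)⟩

theorem KnowsAncestors.leaves_iff {E : Finset (V × V)} {u : V} {K : List (V × V)}
    (h : KnowsAncestors E u K) {v : V} (hv : Reaches E v u) :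
    LeavesComp (fun e => e ∈ K) v ↔ LeavesComp (fun e => e ∈ E) v := by
  unfold LeavesComp
  simp only [h.mutual_iff hv]
  refine exists_congr fun e => ⟨fun h1 => ⟨((h e).1 h1.1).1, h1.2⟩, fun h1 => ⟨?_, h1.2⟩⟩
  exact (h e).2 ⟨h1.1, h1.2.1.2.trans hv⟩

theorem KnowsAncestors.rep_iff {E : Finset (V × V)} {u : V} {K : List (V × V)}
    (h : KnowsAncestors E u K) {v : V} (hv : Reaches E v u) :
    IsRep (fun e => e ∈ K) v ↔ IsRep (fun e => e ∈ E) v := by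
  unfold IsRep
  simp only [h.mutual_iff hv]

/-- A node may be known merely as the head of an edge without being an ancestor. This shows that no
known edge leaves its component, so it is never taken for part of a source component. -/
theorem KnowsAncestors.reaches_of_leaves {E : Finset (V × V)} {u : V} {K : List (V × V)}
    (h : KnowsAncestors E u K) {v : V} (hv : LeavesComp (fun e => e ∈ K) v) : Reaches E v u := by
  obtain ⟨e, he, h1, -⟩ := hv
  exact (h.reaches_of h1.1).trans ((h e).1 he).2

theorem KnowsAncestors.decision {E : Finset (V × V)} {u : V} {K : List (V × V)}
    (h : KnowsAncestors E u K) :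
    ((classify u K).val.2 = Decision.exit ↔
      ¬ EntersComp (fun e => e ∈ E) u ∧ ¬ LeavesComp (fun e => e ∈ E) u) ∧
    ((classify u K).val.2 = Decision.phase3 ↔ SourceRep E u) ∧
    ((classify u K).val.2 = Decision.phase2 ↔ TargetRep E u) := by
  have hu : Reaches E u u := .refl
  rw [SourceRep, TargetRep, ← h.enters_iff hu, ← h.leaves_iff hu, ← h.rep_iff hu]
  exact classify_decision u K

theorem KnowsAncestors.mem_runPhase2 [Fintype V] {E : Finset (V × V)} {u : V} {K : List (V × V)}
    (h : KnowsAncestors E u K) (r : V) :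
    r ∈ (runPhase2 (classify u K).val.1).val ↔ SourceRep E r ∧ Reaches E r u := by
  rw [classify_table, (runPhase2_spec (computeSCCs_describes u K)).1 r]
  constructor
  · rintro ⟨-, h1, h2, h3⟩
    have h4 := h.reaches_of_leaves h2
    rw [h.enters_iff h4] at h1
    rw [h.leaves_iff h4] at h2
    rw [h.rep_iff h4] at h3
    exact ⟨⟨h1, h2, h3⟩, h4⟩
  · rintro ⟨⟨h1, h2, h3⟩, h4⟩
    rw [← h.enters_iff h4] at h1
    rw [← h.leaves_iff h4] at h2
    rw [← h.rep_iff h4] at h3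
    refine ⟨?_, h1, h2, h3⟩
    -- An ancestor occurs in the memory of `u` either as `u` itself or as the tail of the first edge
    -- of a known path.
    rcases Relation.ReflTransGen.cases_head (h.reaches .refl h4) with h5 | ⟨c, h5, -⟩
    · exact Or.inl h5
    · exact Or.inr ⟨_, h5, Or.inl rfl⟩

end Knowledge

/-! ### Edge propagation in the network -/

section Propagation

variable {V : Type} [Fintype V] [LinearOrder V]

theorem mem_outNbrs (E : Finset (V × V)) (u v : V) : v ∈ outNbrs E u ↔ (u, v) ∈ E := by
  simp [outNbrs]

theorem mem_inNbrs (E : Finset (V × V)) (u v : V) : v ∈ inNbrs E u ↔ (v, u) ∈ E := by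
  simp [inNbrs]

theorem outNbrs_length_le (E : Finset (V × V)) (u : V) :
    (outNbrs E u).length ≤ Fintype.card V := by
  rw [outNbrs, Finset.length_sort]; exact Finset.card_le_univ _

theorem inNbrs_length_le (E : Finset (V × V)) (u : V) :
    (inNbrs E u).length ≤ Fintype.card V := by
  rw [inNbrs, Finset.length_sort]; exact Finset.card_le_univ _

/-- There is a walk of length `n` from `a` to `b`. -/
def Walk (E : Finset (V × V)) : ℕ → V → V → Prop
  | 0, a, b => a = b
  | n + 1, a, b => ∃ c, (a, c) ∈ E ∧ Walk E n c b

theorem walk_snoc {E : Finset (V × V)} {n : ℕ} {a b : V} :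
    Walk E (n + 1) a b ↔ ∃ c, Walk E n a c ∧ (c, b) ∈ E := by
  induction n generalizing a with
  | zero =>
    simp only [Walk]
    exact ⟨fun ⟨c, h, h'⟩ => ⟨a, rfl, h' ▸ h⟩, fun ⟨c, h, h'⟩ => ⟨b, h ▸ h', rfl⟩⟩
  | succ n ih =>
    constructor
    · rintro ⟨c, h, h'⟩
      obtain ⟨d, h1, h2⟩ := ih.1 h'
      exact ⟨d, ⟨c, h, h1⟩, h2⟩
    · rintro ⟨d, ⟨c, h, h1⟩, h2⟩
      exact ⟨c, h, ih.2 ⟨d, h1, h2⟩⟩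

theorem reaches_iff_walk {E : Finset (V × V)} {a b : V} :
    Reaches E a b ↔ ∃ n, Walk E n a b := by
  constructor
  · intro h
    induction h using Relation.ReflTransGen.head_induction_on with
    | refl => exact ⟨0, rfl⟩
    | head hac _ ih => obtain ⟨n, hn⟩ := ih; exact ⟨n + 1, _, hac, hn⟩
  · rintro ⟨n, hn⟩
    induction n generalizing a with
    | zero => rw [show a = b from hn]; exact .refl
    | succ n ih => obtain ⟨c, h, h'⟩ := hn; exact .head h (ih h')

/-- If no edge starts at distance `k ≥ 1` from `u`, then all ancestors of `u` are at a distance less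
than `k`. -/
theorem walk_lt_of_no_fresh {E : Finset (V × V)} {k : ℕ} (hk : 1 ≤ k) {u : V}
    (h : ∀ e ∈ E, ¬ (Walk E k e.1 u ∧ ∀ n < k, ¬ Walk E n e.1 u)) {n : ℕ} {a : V}
    (hn : Walk E n a u) : ∃ m < k, Walk E m a u := by
  induction n generalizing a with
  | zero => exact ⟨0, hk, hn⟩
  | succ n ih =>
    obtain ⟨c, h1, h2⟩ := hn
    obtain ⟨m, hm, h3⟩ := ih h2
    have h4 : Walk E (m + 1) a u := ⟨c, h1, h3⟩
    rcases Nat.lt_or_ge (m + 1) k with h5 | h5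
    · exact ⟨m + 1, h5, h4⟩
    · obtain rfl : m + 1 = k := by omega
      by_contra! h6
      exact h _ h1 ⟨h4, h6⟩

/-- The state after `k` iterations of edge propagation from the state `c₀`. -/
structure PropInv (E : Finset (V × V)) (c₀ : Config V) (k : ℕ) (c : Config V) : Prop where
  round_eq : c.round = c₀.round
  added_eq : c.added = c₀.added
  exited_eq : c.exited = c₀.exited
  iter_eq : c.iter = k + 1
  valid : ∀ u, (c.mem u).Valid
  known_iff : ∀ u e, e ∈ (c.mem u).known ↔
    e ∈ E ∪ c₀.added ∧ ∃ n ≤ k, Walk (E ∪ c₀.added) n e.1 u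
  fresh_iff : ∀ u e, e ∈ (c.mem u).fresh ↔ e ∈ E ∪ c₀.added ∧
    (Walk (E ∪ c₀.added) k e.1 u ∧ ∀ n < k, ¬ Walk (E ∪ c₀.added) n e.1 u)
  -- Amortised accounting: the terms with `known` pay for sending and receiving every known edge
  -- once. Fresh edges are paid for on the right but only transmitted in the next iteration, hence
  -- the credit on the left.
  time_le : ∀ u, c.time u + (outNbrs (E ∪ c₀.added) u).length * (c.mem u).fresh.length +
      ((inNbrs (E ∪ c₀.added) u).map fun v => (c.mem v).fresh.length).sum ≤
    c₀.time u + k * (1 + (outNbrs (E ∪ c₀.added) u).length + (inNbrs (E ∪ c₀.added) u).length) +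
      (outNbrs (E ∪ c₀.added) u).length * (c.mem u).known.length +
      ((inNbrs (E ∪ c₀.added) u).map fun v => (c.mem v).known.length).sum +
      3 * (c.mem u).known.length
  -- An agent with fresh edges has learnt something in every iteration, which bounds the number of
  -- iterations by the number of edges.
  progress : ∀ u, (c.mem u).fresh ≠ [] → k ≤ (c.mem u).known.length

theorem propInv_startRound (E : Finset (V × V)) (r : ℕ) (added : Finset (V × V)) (time : V → ℕ)
    (exited : V → Bool) :
    PropInv E (startRound E r added time exited) 0 (startRound E r added time exited) := by
  have h := fun u => absorbed_initMem u (outNbrs (E ∪ added) u)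
  have hmem : ∀ u (e : V × V), e ∈ ({e | e.1 = u ∧ e.2 ∈ outNbrs (E ∪ added) u} : Set (V × V)) ↔
      e ∈ E ∪ added ∧ e.1 = u := by
    rintro u ⟨a, b⟩
    simp only [Set.mem_ofPred_eq, mem_outNbrs]
    constructor
    · rintro ⟨rfl, h⟩; exact ⟨h, rfl⟩
    · rintro ⟨h, rfl⟩; exact ⟨rfl, h⟩
  have hlen : ∀ u, (initMem u (outNbrs (E ∪ added) u)).val.known.length =
      (initMem u (outNbrs (E ∪ added) u)).val.fresh.length := fun u => by
    simpa using (h u).length_eq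
  refine ⟨rfl, rfl, rfl, rfl, fun u => (h u).valid, fun u e => ?_, fun u e => ?_, fun u => ?_,
    fun u _ => Nat.zero_le _⟩
  · refine ((h u).known_iff e).trans ?_
    rw [hmem]
    simp only [List.not_mem_nil, false_or, Nat.le_zero, exists_eq_left, Walk]
    rfl
  · refine ((h u).fresh_iff e).trans ?_
    rw [hmem]
    simp only [List.not_mem_nil, false_or, not_false_eq_true, and_true, Nat.not_lt_zero,
      false_imp_iff, implies_true, Walk]
    rfl
  · simp only [startRound, hlen]
    omega

/-- The unconditional first iteration yields `1 ≤ k`. This is essential: an agent without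
out-neighbors starts with no edges, yet may have ancestors. -/
theorem PropInv.fresh_nil_of_not_propagating {E : Finset (V × V)} {c₀ c : Config V} {k : ℕ}
    (h : PropInv E c₀ k c) (hex : ∀ u, c₀.exited u = false) {u : V} (hu : ¬ c.propagating u) :
    1 ≤ k ∧ (c.mem u).fresh = [] := by
  rw [Config.propagating, h.exited_eq, hex, h.iter_eq, active] at hu
  simp only [Bool.not_false, Bool.true_and, Bool.or_eq_true, beq_iff_eq, not_or,
    Bool.not_eq_eq_eq_not, Bool.not_true, List.isEmpty_eq_false_iff, not_not] at hu
  exact ⟨by omega, hu.2⟩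

/-- A stopped agent sends nothing, but its `fresh` is empty anyway; so every message may be taken to
be the sender's `fresh`. -/
theorem PropInv.propagateAgent_eq {E : Finset (V × V)} {order : ArrivalOrder V} {c₀ c : Config V}
    {k : ℕ} (h : PropInv E c₀ k c) (hex : ∀ u, c₀.exited u = false) (u : V) :
    propagateAgent E order c u = if c.propagating u then
      propagateBody (outNbrs (E ∪ c₀.added) u)
        ((order c.round u (inNbrs (E ∪ c₀.added) u)).map fun v => (c.mem v).fresh) (c.mem u)
      else pure (c.mem u) := by
  have h1 : ∀ v, (if c.propagating v then (c.mem v).fresh else []) = (c.mem v).fresh := by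
    intro v
    split
    · rfl
    · next hv => rw [(h.fresh_nil_of_not_propagating hex hv).2]
  simp only [propagateAgent, h1, h.added_eq]

theorem PropInv.step {E : Finset (V × V)} {order : ArrivalOrder V}
    (hord : ∀ r u l, (order r u l).Perm l) {c₀ c : Config V} {k : ℕ} (h : PropInv E c₀ k c)
    (hex : ∀ u, c₀.exited u = false) : PropInv E c₀ (k + 1) (propagateStep E order c) := by
  have hag := h.propagateAgent_eq (order := order) hex
  have hagent : ∀ u, ((propagateAgent E order c u).val.Valid ∧
      (∀ e, e ∈ (propagateAgent E order c u).val.known ↔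
        e ∈ E ∪ c₀.added ∧ ∃ n ≤ k + 1, Walk (E ∪ c₀.added) n e.1 u) ∧
      (∀ e, e ∈ (propagateAgent E order c u).val.fresh ↔ e ∈ E ∪ c₀.added ∧
        (Walk (E ∪ c₀.added) (k + 1) e.1 u ∧
          ∀ n < k + 1, ¬ Walk (E ∪ c₀.added) n e.1 u)) ∧
      (propagateAgent E order c u).val.known.length =
        (c.mem u).known.length + (propagateAgent E order c u).val.fresh.length ∧
      ((propagateAgent E order c u).val.fresh ≠ [] →
        k + 1 ≤ (propagateAgent E order c u).val.known.length)) := by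
    intro u
    rw [hag]
    split
    · next hu =>
      have h1 := absorbed_propagateBody (outNbrs (E ∪ c₀.added) u)
        ((order c.round u (inNbrs (E ∪ c₀.added) u)).map fun v => (c.mem v).fresh) (h.valid u)
      generalize (propagateBody (outNbrs (E ∪ c₀.added) u)
        ((order c.round u (inNbrs (E ∪ c₀.added) u)).map fun v => (c.mem v).fresh)
        (c.mem u)).val = m at h1
      have h2 : ∀ e, e ∈ m.known ↔ e ∈ E ∪ c₀.added ∧ ∃ n ≤ k + 1, Walk (E ∪ c₀.added) n e.1 u := by
        intro e
        rw [h1.known_iff]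
        simp only [Set.mem_ofPred_eq, List.mem_map, exists_exists_and_eq_and,
          (hord _ _ _).mem_iff, mem_inNbrs, h.fresh_iff]
        rw [show e ∈ (c.mem u).known ↔ _ from h.known_iff u e]
        constructor
        · rintro (⟨h2, n, h3, h4⟩ | ⟨v, h2, h3, h4, -⟩)
          · exact ⟨h2, n, by omega, h4⟩
          · exact ⟨h3, k + 1, le_rfl, walk_snoc.2 ⟨v, h4, h2⟩⟩
        · rintro ⟨h2, n, h3, h4⟩
          by_cases h5 : ∃ n ≤ k, Walk (E ∪ c₀.added) n e.1 u
          · exact Or.inl ⟨h2, h5⟩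
          · push Not at h5
            obtain rfl : n = k + 1 := by
              by_contra h6
              exact h5 n (by omega) h4
            obtain ⟨v, h6, h7⟩ := walk_snoc.1 h4
            -- The last edge of a shortest walk from `e.1` to `u` comes from some `v` at distance
            -- exactly `k` from `e.1`: a shorter walk to `v` would give one to `u` of length at most
            -- `k`. Hence `e` is fresh at `v`.
            refine Or.inr ⟨v, h7, h2, h6, fun n hn h8 => h5 (n + 1) hn (walk_snoc.2 ⟨v, h8, h7⟩)⟩
      have hlen := h1.length_eq
      simp only [List.length_nil, add_zero] at hlen
      refine ⟨h1.valid, h2, fun e => ?_, hlen, fun hne => ?_⟩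
      · have h3 := h1.fresh_iff e
        have h4 := h1.known_iff e
        simp only [List.not_mem_nil, false_or] at h3
        have h5 : e ∈ m.fresh ↔ e ∈ m.known ∧ e ∉ (c.mem u).known := by
          rw [h3, h4]
          tauto
        rw [h5, h2, h.known_iff]
        constructor
        · rintro ⟨⟨h6, n, h7, h8⟩, h9⟩
          have h10 : ∀ n < k + 1, ¬ Walk (E ∪ c₀.added) n e.1 u :=
            fun n hn h10 => h9 ⟨h6, n, by omega, h10⟩
          obtain rfl : n = k + 1 := by
            by_contra h11
            exact h10 n (by omega) h8
          exact ⟨h6, h8, h10⟩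
        · rintro ⟨h6, h7, h8⟩
          exact ⟨⟨h6, k + 1, le_rfl, h7⟩, fun ⟨_, n, hn, h9⟩ => h8 n (by omega) h9⟩
      · have h3 := List.length_pos_iff.2 hne
        rcases Nat.eq_zero_or_pos k with h4 | h4
        · omega
        · have h5 : (c.mem u).fresh ≠ [] := by
            intro h5
            rw [Config.propagating, h.iter_eq, active, h5] at hu
            simp at hu
            omega
          have := h.progress u h5
          omega
    · next hu =>
      -- The memory of a stopped agent is unchanged, and it already satisfies the invariant for `k +
      -- 1`, since no tail is at distance `k` or more.
      obtain ⟨hk, hnil⟩ := h.fresh_nil_of_not_propagating hex hu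
      have h1 : ∀ e ∈ E ∪ c₀.added, ¬ (Walk (E ∪ c₀.added) k e.1 u ∧
          ∀ n < k, ¬ Walk (E ∪ c₀.added) n e.1 u) := by
        intro e he h1
        have := (h.fresh_iff u e).2 ⟨he, h1⟩
        simp [hnil] at this
      simp only [Timed.val_pure]
      refine ⟨h.valid u, fun e => ?_, fun e => ?_, by simp [hnil], fun h2 => absurd hnil h2⟩
      · rw [h.known_iff]
        refine and_congr_right fun _ => ⟨fun ⟨n, hn, h2⟩ => ⟨n, by omega, h2⟩, fun ⟨n, _, h2⟩ => ?_⟩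
        obtain ⟨m, hm, h3⟩ := walk_lt_of_no_fresh hk h1 h2
        exact ⟨m, hm.le, h3⟩
      · rw [hnil]
        simp only [List.not_mem_nil, false_iff]
        rintro ⟨-, h2, h3⟩
        obtain ⟨m, hm, h4⟩ := walk_lt_of_no_fresh hk h1 h2
        exact h3 m (by omega) h4
  refine ⟨h.round_eq, h.added_eq, h.exited_eq, by simp [propagateStep, h.iter_eq],
    fun u => (hagent u).1, fun u => (hagent u).2.1, fun u => (hagent u).2.2.1, fun u => ?_,
    fun u => (hagent u).2.2.2.2⟩
  change c.time u + (propagateAgent E order c u).time +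
    (outNbrs (E ∪ c₀.added) u).length * (propagateAgent E order c u).val.fresh.length +
    ((inNbrs (E ∪ c₀.added) u).map fun v =>
      (propagateAgent E order c v).val.fresh.length).sum ≤ c₀.time u +
    (k + 1) * (1 + (outNbrs (E ∪ c₀.added) u).length + (inNbrs (E ∪ c₀.added) u).length) +
    (outNbrs (E ∪ c₀.added) u).length * (propagateAgent E order c u).val.known.length +
    ((inNbrs (E ∪ c₀.added) u).map fun v =>
      (propagateAgent E order c v).val.known.length).sum +
    3 * (propagateAgent E order c u).val.known.length
  have h1 : ∀ v, (propagateAgent E order c v).val.known.length =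
      (c.mem v).known.length + (propagateAgent E order c v).val.fresh.length :=
    fun v => (hagent v).2.2.2.1
  have h2 : (propagateAgent E order c u).time + 3 * (c.mem u).known.length ≤
      1 + (outNbrs (E ∪ c₀.added) u).length * (1 + (c.mem u).fresh.length) +
      ((inNbrs (E ∪ c₀.added) u).length +
        ((inNbrs (E ∪ c₀.added) u).map fun v => (c.mem v).fresh.length).sum) +
      3 * (propagateAgent E order c u).val.known.length := by
    rw [hag]
    split
    · have h3 := propagateBody_time (outNbrs (E ∪ c₀.added) u)
        ((order c.round u (inNbrs (E ∪ c₀.added) u)).map fun v => (c.mem v).fresh) (c.mem u)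
      have h4 : ((((order c.round u (inNbrs (E ∪ c₀.added) u)).map fun v =>
          (c.mem v).fresh).map fun msg => 1 + msg.length).sum) =
          (inNbrs (E ∪ c₀.added) u).length +
            ((inNbrs (E ∪ c₀.added) u).map fun v => (c.mem v).fresh.length).sum := by
        rw [List.map_map, ((hord _ _ _).map _).sum_eq]
        have : ((fun msg : List (V × V) => 1 + msg.length) ∘ fun v => (c.mem v).fresh) =
          fun v => 1 + (c.mem v).fresh.length := rfl
        rw [this, List.sum_map_add]
        simp
      omega
    · simp only [Timed.time_pure, Timed.val_pure]; omega
  have h3 := h.time_le u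
  have h4 : ((inNbrs (E ∪ c₀.added) u).map fun v =>
      (propagateAgent E order c v).val.known.length).sum =
      ((inNbrs (E ∪ c₀.added) u).map fun v => (c.mem v).known.length).sum +
      ((inNbrs (E ∪ c₀.added) u).map fun v =>
        (propagateAgent E order c v).val.fresh.length).sum := by
    rw [← List.sum_map_add]
    simp only [h1]
  rw [h4, h1 u]
  rw [h1 u] at h2
  generalize (propagateAgent E order c u).val.fresh.length = f at *
  generalize (propagateAgent E order c u).time = t at *
  generalize (outNbrs (E ∪ c₀.added) u).length = o at *
  generalize (inNbrs (E ∪ c₀.added) u).length = i at *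
  nlinarith

theorem PropInv.iterate {E : Finset (V × V)} {order : ArrivalOrder V}
    (hord : ∀ r u l, (order r u l).Perm l) {c₀ : Config V} (h : PropInv E c₀ 0 c₀)
    (hex : ∀ u, c₀.exited u = false) (k : ℕ) :
    PropInv E c₀ k ((propagateStep E order)^[k] c₀) := by
  induction k with
  | zero => exact h
  | succ k ih =>
    rw [Function.iterate_succ_apply']
    exact ih.step hord hex

theorem PropInv.known_length_le {E : Finset (V × V)} {c₀ c : Config V} {k : ℕ}
    (h : PropInv E c₀ k c) (u : V) : (c.mem u).known.length ≤ (E ∪ c₀.added).card := by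
  rw [← List.toFinset_card_of_nodup (h.valid u).nodup]
  refine Finset.card_le_card fun e he => ?_
  exact ((h.known_iff u e).1 (List.mem_toFinset.1 he)).1

theorem PropInv.le_card_of_propagating {E : Finset (V × V)} {c₀ c : Config V} {k : ℕ}
    (h : PropInv E c₀ k c) {u : V} (hu : c.propagating u = true) : k ≤ (E ∪ c₀.added).card := by
  rcases Nat.eq_zero_or_pos k with h1 | h1
  · omega
  · refine (h.progress u fun h2 => ?_).trans (h.known_length_le u)
    rw [Config.propagating, h.iter_eq, active, h2] at hu
    simp at hu
    omega

theorem PropInv.knowsAncestors {E : Finset (V × V)} {c₀ c : Config V} {k : ℕ}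
    (h : PropInv E c₀ k c) (hex : ∀ u, c₀.exited u = false) (hc : ¬ ∃ u, c.propagating u = true)
    (u : V) : KnowsAncestors (E ∪ c₀.added) u (c.mem u).known := by
  obtain ⟨hk, hnil⟩ := h.fresh_nil_of_not_propagating hex fun hu => hc ⟨u, hu⟩
  intro e
  rw [h.known_iff, reaches_iff_walk]
  refine and_congr_right fun _ => ⟨fun ⟨n, _, h1⟩ => ⟨n, h1⟩, fun ⟨n, h1⟩ => ?_⟩
  obtain ⟨m, hm, h2⟩ := walk_lt_of_no_fresh hk (fun e he h2 => by
    have := (h.fresh_iff u e).2 ⟨he, h2⟩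
    simp [hnil] at this) h1
  exact ⟨m, hm.le, h2⟩

theorem PropInv.time_le_mul {E : Finset (V × V)} {c₀ c : Config V} {k : ℕ}
    (h : PropInv E c₀ k c) (hk : k ≤ (E ∪ c₀.added).card + 1) (hE : 1 ≤ (E ∪ c₀.added).card)
    (u : V) : c.time u ≤ c₀.time u + 11 * (Fintype.card V * (E ∪ c₀.added).card) := by
  have hn : 1 ≤ Fintype.card V := Fintype.card_pos_iff.2 ⟨u⟩
  have h1 := h.time_le u
  have h2 := outNbrs_length_le (E ∪ c₀.added) u
  have h3 := inNbrs_length_le (E ∪ c₀.added) u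
  have h4 := h.known_length_le u
  have h5 : ((inNbrs (E ∪ c₀.added) u).map fun v => (c.mem v).known.length).sum ≤
      (inNbrs (E ∪ c₀.added) u).length * (E ∪ c₀.added).card := by
    have := List.sum_le_card_nsmul ((inNbrs (E ∪ c₀.added) u).map fun v => (c.mem v).known.length)
      (E ∪ c₀.added).card (fun x hx => by
        obtain ⟨v, -, rfl⟩ := List.mem_map.1 hx
        exact h.known_length_le v)
    simpa using this
  generalize (outNbrs (E ∪ c₀.added) u).length = o at *
  generalize (inNbrs (E ∪ c₀.added) u).length = i at *
  generalize (E ∪ c₀.added).card = m at *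
  generalize Fintype.card V = n at *
  -- The fixed cost per iteration uses `k ≤ m + 1 ≤ 2 * m`. The coefficient 11 is 6 for this, 1 for
  -- sending, 1 for receiving and 3 for recording.
  have h6 : k * (1 + o + i) ≤ (2 * m) * (3 * n) := Nat.mul_le_mul (by omega) (by omega)
  have h7 : o * (c.mem u).known.length ≤ n * m := Nat.mul_le_mul h2 h4
  have h8 : i * m ≤ n * m := Nat.mul_le_mul_right m h3
  have h9 : m ≤ n * m := Nat.le_mul_of_pos_left m hn
  have h10 : (2 * m) * (3 * n) = 6 * (n * m) := by ring
  omega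

theorem startRound_time_le (E : Finset (V × V)) (r : ℕ) (added : Finset (V × V)) (time : V → ℕ)
    (exited : V → Bool) (hE : 1 ≤ (E ∪ added).card) (u : V) :
    (startRound E r added time exited).time u ≤
      time u + 4 * (Fintype.card V * (E ∪ added).card) := by
  have hn : 1 ≤ Fintype.card V := Fintype.card_pos_iff.2 ⟨u⟩
  have h1 := initMem_time u (outNbrs (E ∪ added) u)
  have h2 := outNbrs_length_le (E ∪ added) u
  have h3 := (propInv_startRound E r added time exited).known_length_le u
  change (initMem u (outNbrs (E ∪ added) u)).val.known.length ≤ (E ∪ added).card at h3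
  have h4 : (E ∪ added).card ≤ Fintype.card V * (E ∪ added).card := Nat.le_mul_of_pos_left _ hn
  have h5 : Fintype.card V ≤ Fintype.card V * (E ∪ added).card := Nat.le_mul_of_pos_right _ hE
  simp only [startRound]
  split <;> omega

end Propagation

/-! ### Phases 2, 3 and 4 in the network -/

section Phases

variable {V : Type} [LinearOrder V]

theorem findLarge_eq_none {inbox : List (V × List V)} :
    (findLarge inbox).val = none ↔ ∀ p ∈ inbox, p.2.length ≤ 1 := by
  induction inbox with
  | nil => simp [findLarge]
  | cons p inbox ih =>
    simp only [findLarge, Timed.val_bind]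
    split
    · next h => simp; omega
    · next h => simp [ih]; omega

theorem mem_of_findLarge_eq_some {inbox : List (V × List V)} {t : V}
    (h : (findLarge inbox).val = some t) : t ∈ inbox.map Prod.fst := by
  induction inbox with
  | nil => simp [findLarge] at h
  | cons p inbox ih =>
    simp only [findLarge, Timed.val_bind] at h
    split at h
    · simp at h; simp [h]
    · have := ih h
      simp only [List.map_cons, List.mem_cons]
      exact Or.inr this

theorem findLarge_time (inbox : List (V × List V)) : (findLarge inbox).time ≤ inbox.length := by
  induction inbox with
  | nil => simp [findLarge]
  | cons p inbox ih =>
    simp only [findLarge, Timed.time_bind, time_charge, List.length_cons]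
    split
    · simp
    · omega

theorem receiveAll_time {inbox : List (V × List V)} {n : ℕ} (h1 : inbox.length ≤ n)
    (h2 : ∀ p ∈ inbox, p.2.length ≤ n) : (receiveAll inbox).time ≤ n * (1 + n) := by
  have := Timed.foldlM_time_le_sum (fun (_ : Unit) (p : V × List V) => charge (1 + p.2.length))
    (fun _ => 1 + n) inbox (fun _ p hp => by simpa using h2 p hp) ()
  simp only [List.map_const', List.sum_replicate, smul_eq_mul] at this
  exact this.trans (Nat.mul_le_mul_right _ h1)

theorem runPhase3_val (u : V) (inbox : List (V × List V)) :
    (runPhase3 u inbox).val = match (findLarge inbox).val with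
      | some t => (some t, [])
      | none => (none, inbox.map fun p => (p.1, u)) := by
  rcases h : (findLarge inbox).val with _ | t <;> simp [runPhase3, h]

theorem runPhase3_time (u : V) {inbox : List (V × List V)} {n : ℕ} (h1 : inbox.length ≤ n)
    (h2 : ∀ p ∈ inbox, p.2.length ≤ n) :
    (runPhase3 u inbox).time ≤ n * (1 + n) + 2 * n + 1 := by
  have h3 := receiveAll_time h1 h2
  have h4 := findLarge_time inbox
  simp only [runPhase3, Timed.time_bind]
  split <;> simp only [Timed.time_bind, time_charge, Timed.time_pure] <;> omega

/-- Only the branch without selection is needed, because with a single source or target no `P_s`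
arriving in Phase 4 has more than one element. -/
theorem runPhase4_val (u : V) {inbox : List (V × List V)} (h : ∀ p ∈ inbox, p.2.length ≤ 1) :
    (runPhase4 u inbox).val = inbox.map fun p => (u, p.1) := by
  simp only [runPhase4, Timed.val_bind, findLarge_eq_none.2 h, Timed.val_pure]

theorem runPhase4_time (u : V) {inbox : List (V × List V)} {n : ℕ} (h1 : inbox.length ≤ n)
    (h2 : ∀ p ∈ inbox, p.2.length ≤ n) :
    (runPhase4 u inbox).time ≤ n * (1 + n) + 2 * n + 2 := by
  have h3 := receiveAll_time h1 h2
  have h4 := findLarge_time inbox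
  simp only [runPhase4, Timed.time_bind, time_charge]
  split <;> simp only [Timed.time_bind, time_charge, Timed.time_pure] <;> omega

variable [Fintype V]

/-- A state in which edge propagation has ended, and all agents are still running. -/
structure Informed (G : Finset (V × V)) (c : Config V) : Prop where
  exited : ∀ u, c.exited u = false
  knows : ∀ u, KnowsAncestors G u (c.mem u).known
  nodup : ∀ u, (c.mem u).known.Nodup

variable {G : Finset (V × V)} {c : Config V} {order : ArrivalOrder V}

theorem Informed.phase1_eq (h : Informed G c) (u : V) :
    phase1 c u = classify u (c.mem u).known := by
  simp [phase1, h.exited]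

theorem Informed.phase1_eq_exit (h : Informed G c) (u : V) :
    (phase1 c u).val.2 = Decision.exit ↔
      ¬ EntersComp (fun e => e ∈ G) u ∧ ¬ LeavesComp (fun e => e ∈ G) u := by
  rw [h.phase1_eq]; exact (h.knows u).decision.1

theorem Informed.phase1_eq_phase3 (h : Informed G c) (u : V) :
    (phase1 c u).val.2 = Decision.phase3 ↔ SourceRep G u := by
  rw [h.phase1_eq]; exact (h.knows u).decision.2.1

theorem Informed.phase1_eq_phase2 (h : Informed G c) (u : V) :
    (phase1 c u).val.2 = Decision.phase2 ↔ TargetRep G u := by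
  rw [h.phase1_eq]; exact (h.knows u).decision.2.2

theorem Informed.phase2_of (h : Informed G c) {u : V} (hu : TargetRep G u) :
    phase2 c u = runPhase2 (phase1 c u).val.1 := by
  simp [phase2, (h.phase1_eq_phase2 u).2 hu]

theorem Informed.phase2_of_not (h : Informed G c) {u : V} (hu : ¬ TargetRep G u) :
    phase2 c u = pure [] := by
  unfold phase2
  split
  · next h1 => exact absurd ((h.phase1_eq_phase2 u).1 h1) hu
  · rfl

theorem Informed.mem_phase2 (h : Informed G c) (u r : V) :
    r ∈ (phase2 c u).val ↔ TargetRep G u ∧ SourceRep G r ∧ Reaches G r u := by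
  by_cases hu : TargetRep G u
  · rw [h.phase2_of hu, h.phase1_eq, (h.knows u).mem_runPhase2]
    simp [hu]
  · simp [h.phase2_of_not hu, hu]

theorem Informed.phase2_nodup (h : Informed G c) (u : V) : (phase2 c u).val.Nodup := by
  by_cases hu : TargetRep G u
  · rw [h.phase2_of hu, h.phase1_eq, classify_table]
    exact (runPhase2_spec (computeSCCs_describes u _)).2.1
  · simp [h.phase2_of_not hu]

theorem Informed.phase2_time (h : Informed G c) (u : V) :
    (phase2 c u).time ≤ 5 * Fintype.card V + Fintype.card V * (1 + Fintype.card V) := by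
  by_cases hu : TargetRep G u
  · rw [h.phase2_of hu, h.phase1_eq, classify_table]
    exact (runPhase2_spec (computeSCCs_describes u _)).2.2
  · simp [h.phase2_of_not hu]

theorem Informed.phase3_of (h : Informed G c) {u : V} (hu : SourceRep G u) :
    phase3 order c u = runPhase3 u (inbox3 order c u) := by
  simp [phase3, (h.phase1_eq_phase3 u).2 hu]

theorem Informed.phase3_of_not (h : Informed G c) {u : V} (hu : ¬ SourceRep G u) :
    phase3 order c u = pure (none, []) := by
  unfold phase3
  split
  · next h1 => exact absurd ((h.phase1_eq_phase3 u).1 h1) hu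
  · rfl

theorem Informed.phase4_of (h : Informed G c) {u : V} (hu : TargetRep G u) :
    phase4 order c u = runPhase4 u (inbox4 order c u) := by
  simp [phase4, (h.phase1_eq_phase2 u).2 hu]

theorem Informed.phase4_of_not (h : Informed G c) {u : V} (hu : ¬ TargetRep G u) :
    phase4 order c u = pure [] := by
  unfold phase4
  split
  · next h1 => exact absurd ((h.phase1_eq_phase2 u).1 h1) hu
  · rfl

/-! ### Contents of the inboxes and the time of one round -/

theorem senders_nodup (hord : ∀ r u l, (order r u l).Perm l) (r : ℕ) (u : V) (A : Finset V) :
    (order r u (A.sort (· ≤ ·))).Nodup :=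
  (hord r u _).nodup_iff.2 (A.sort_nodup _)

theorem mem_inbox3 (hord : ∀ r u l, (order r u l).Perm l) (u : V) (p : V × List V) :
    p ∈ inbox3 order c u ↔ u ∈ (phase2 c p.1).val ∧ p.2 = (phase2 c p.1).val := by
  obtain ⟨t, R⟩ := p
  simp only [inbox3, List.mem_map, (hord _ _ _).mem_iff, Finset.mem_sort, Finset.mem_filter,
    Finset.mem_univ, true_and, Prod.mk.injEq]
  constructor
  · rintro ⟨_, h, rfl, rfl⟩; exact ⟨h, rfl⟩
  · rintro ⟨h, rfl⟩; exact ⟨t, h, rfl, rfl⟩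

theorem inbox3_fst (u : V) : (inbox3 order c u).map Prod.fst = order c.round u
    ((Finset.univ.filter fun t => u ∈ (phase2 c t).val).sort (· ≤ ·)) := by
  rw [inbox3, List.map_map]
  exact List.map_id _

theorem inbox3_length_le (hord : ∀ r u l, (order r u l).Perm l) (u : V) :
    (inbox3 order c u).length ≤ Fintype.card V := by
  rw [← List.length_map Prod.fst, inbox3_fst]
  exact (senders_nodup hord _ _ _).length_le_card

theorem mem_inbox4 (hord : ∀ r u l, (order r u l).Perm l) (u : V) (p : V × List V) :
    p ∈ inbox4 order c u ↔ (phase3 order c p.1).val.1 = some u ∧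
      p.2 = (inbox3 order c p.1).map Prod.fst := by
  obtain ⟨t, R⟩ := p
  simp only [inbox4, List.mem_map, (hord _ _ _).mem_iff, Finset.mem_sort, Finset.mem_filter,
    Finset.mem_univ, true_and, Prod.mk.injEq]
  constructor
  · rintro ⟨_, h, rfl, rfl⟩; exact ⟨h, rfl⟩
  · rintro ⟨h, rfl⟩; exact ⟨t, h, rfl, rfl⟩

theorem inbox4_length_le (hord : ∀ r u l, (order r u l).Perm l) (u : V) :
    (inbox4 order c u).length ≤ Fintype.card V := by
  rw [inbox4, List.length_map]
  exact (senders_nodup hord _ _ _).length_le_card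

theorem Informed.phase3_time (h : Informed G c) (hord : ∀ r u l, (order r u l).Perm l) (u : V) :
    (phase3 order c u).time ≤
      Fintype.card V * (1 + Fintype.card V) + 2 * Fintype.card V + 1 := by
  by_cases hu : SourceRep G u
  · rw [h.phase3_of hu]
    refine runPhase3_time u (inbox3_length_le hord u) fun p hp => ?_
    rw [((mem_inbox3 hord u p).1 hp).2]
    exact (h.phase2_nodup p.1).length_le_card
  · simp [h.phase3_of_not hu]

theorem Informed.phase4_time (h : Informed G c) (hord : ∀ r u l, (order r u l).Perm l) (u : V) :
    (phase4 order c u).time ≤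
      Fintype.card V * (1 + Fintype.card V) + 2 * Fintype.card V + 2 := by
  by_cases hu : TargetRep G u
  · rw [h.phase4_of hu]
    refine runPhase4_time u (inbox4_length_le hord u) fun p hp => ?_
    rw [((mem_inbox4 hord u p).1 hp).2, List.length_map]
    exact inbox3_length_le hord p.1
  · simp [h.phase4_of_not hu]

/-- Phases 2 to 4 are quadratic in the number of nodes; `hG` turns this into a multiple of nodes
times edges. -/
theorem Informed.round_time (h : Informed G c) (hord : ∀ r u l, (order r u l).Perm l)
    (hG : Fintype.card V ≤ 2 * G.card) (u : V) :
    (phase1 c u).time + (phase2 c u).time + (phase3 order c u).time + (phase4 order c u).time ≤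
      70 * (Fintype.card V * G.card) := by
  have hn : 1 ≤ Fintype.card V := Fintype.card_pos_iff.2 ⟨u⟩
  have h1 : (phase1 c u).time ≤ 19 * Fintype.card V + 15 * (c.mem u).known.length + 11 := by
    rw [h.phase1_eq]; exact classify_time _ _
  have h2 := h.phase2_time u
  have h3 := h.phase3_time hord u
  have h4 := h.phase4_time hord u
  have h5 : (c.mem u).known.length ≤ G.card := by
    rw [← List.toFinset_card_of_nodup (h.nodup u)]
    exact Finset.card_le_card fun e he => ((h.knows u e).1 (List.mem_toFinset.1 he)).1
  generalize Fintype.card V = n at *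
  generalize G.card = m at *
  have h6 : n * n ≤ n * (2 * m) := Nat.mul_le_mul_left n hG
  have h7 : n ≤ n * m := Nat.le_mul_of_pos_right n (by omega)
  have h8 : m ≤ n * m := Nat.le_mul_of_pos_left m hn
  have h9 : n * (2 * m) = 2 * (n * m) := by ring
  have h10 : n * (1 + n) = n + n * n := by ring
  omega

/-- The edges added in Phases 3 and 4. -/
def newEdges (order : ArrivalOrder V) (c : Config V) : Finset (V × V) :=
  Finset.univ.biUnion fun u => ((phase3 order c u).val.2 ++ (phase4 order c u).val).toFinset

/-- A proposal of `t` to `s` becomes the edge `(t, s)` in Phase 3 if `s` selects nobody. Otherwise,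
by `hP`, `t` is the only proposer, so `s` selects it and `t` adds the edge in Phase 4. No proposal
is lost. -/
theorem Informed.mem_newEdges_of (h : Informed G c) (hord : ∀ r u l, (order r u l).Perm l)
    (hP : ∀ s, (phase3 order c s).val.1 ≠ none → (inbox3 order c s).length ≤ 1) (t s : V) :
    (t, s) ∈ newEdges order c ↔ TargetRep G t ∧ SourceRep G s ∧ Reaches G s t := by
  have h3 : ∀ u, (t, s) ∈ (phase3 order c u).val.2 ↔
      u = s ∧ (phase3 order c s).val.1 = none ∧ s ∈ (phase2 c t).val := by
    intro u
    by_cases hu : SourceRep G u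
    · rw [h.phase3_of hu, runPhase3_val]
      rcases hl : (findLarge (inbox3 order c u)).val with _ | t'
      · simp only [List.mem_map, Prod.mk.injEq]
        constructor
        · rintro ⟨p, hp, rfl, rfl⟩
          refine ⟨rfl, ?_, ((mem_inbox3 hord u p).1 hp).1⟩
          rw [h.phase3_of hu, runPhase3_val, hl]
        · rintro ⟨rfl, -, h1⟩
          exact ⟨(t, (phase2 c t).val), (mem_inbox3 hord u _).2 ⟨h1, rfl⟩, rfl, rfl⟩
      · simp only [List.not_mem_nil, false_iff, not_and]
        rintro rfl h1
        rw [h.phase3_of hu, runPhase3_val, hl] at h1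
        simp at h1
    · rw [h.phase3_of_not hu]
      simp only [Timed.val_pure, List.not_mem_nil, false_iff, not_and]
      rintro rfl - h1
      exact hu ((h.mem_phase2 _ _).1 h1).2.1
  have h4 : ∀ u, (t, s) ∈ (phase4 order c u).val ↔
      u = t ∧ TargetRep G t ∧ (phase3 order c s).val.1 = some t := by
    intro u
    by_cases hu : TargetRep G u
    · rw [h.phase4_of hu, runPhase4_val]
      · simp only [List.mem_map, Prod.mk.injEq]
        constructor
        · rintro ⟨p, hp, rfl, rfl⟩
          exact ⟨rfl, hu, ((mem_inbox4 hord u p).1 hp).1⟩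
        · rintro ⟨rfl, -, h1⟩
          exact ⟨(s, (inbox3 order c s).map Prod.fst), (mem_inbox4 hord u _).2 ⟨h1, rfl⟩, rfl, rfl⟩
      · intro p hp
        obtain ⟨h1, h2⟩ := (mem_inbox4 hord u p).1 hp
        rw [h2, List.length_map]
        exact hP p.1 (by simp [h1])
    · rw [h.phase4_of_not hu]
      simp only [Timed.val_pure, List.not_mem_nil, false_iff, not_and]
      rintro rfl h1
      exact absurd h1 hu
  simp only [newEdges, Finset.mem_biUnion, Finset.mem_univ, true_and, List.mem_toFinset,
    List.mem_append, h3, h4]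
  rw [← h.mem_phase2]
  constructor
  · rintro ⟨u, ⟨-, -, h1⟩ | ⟨-, -, h1⟩⟩
    · exact h1
    · by_cases hs : SourceRep G s
      · rw [h.phase3_of hs, runPhase3_val] at h1
        rcases hl : (findLarge (inbox3 order c s)).val with _ | t'
        · simp [hl] at h1
        · simp only [hl, Option.some.injEq] at h1
          subst h1
          obtain ⟨p, hp, rfl⟩ := List.mem_map.1 (mem_of_findLarge_eq_some hl)
          exact ((mem_inbox3 hord s p).1 hp).1
      · rw [h.phase3_of_not hs] at h1
        simp at h1
  · intro h1
    obtain ⟨ht, hs, -⟩ := (h.mem_phase2 _ _).1 h1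
    by_cases h2 : (phase3 order c s).val.1 = none
    · exact ⟨s, Or.inl ⟨rfl, h2, h1⟩⟩
    · refine ⟨t, Or.inr ⟨rfl, ht, ?_⟩⟩
      have h5 := hP s h2
      have h6 : (t, (phase2 c t).val) ∈ inbox3 order c s := (mem_inbox3 hord s _).2 ⟨h1, rfl⟩
      rw [h.phase3_of hs, runPhase3_val] at h2 ⊢
      rcases hl : (findLarge (inbox3 order c s)).val with _ | t'
      · simp [hl] at h2
      · obtain ⟨p, hp, rfl⟩ := List.mem_map.1 (mem_of_findLarge_eq_some hl)
        have h7 : (inbox3 order c s).length = 1 := le_antisymm h5 (List.length_pos_of_mem hp)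
        obtain ⟨q, hq⟩ := List.length_eq_one_iff.1 h7
        rw [hq, List.mem_singleton] at h6 hp
        rw [hp, ← h6]

theorem length_le_one_of_nodup {α : Type} {l : List α} (h : l.Nodup)
    (h' : ∀ a ∈ l, ∀ b ∈ l, a = b) : l.length ≤ 1 := by
  rcases l with _ | ⟨a, _ | ⟨b, l⟩⟩
  · simp
  · simp
  · have := h' a (by simp) b (by simp)
    simp [this] at h

/-- If there is only one source component, or only one target component, then the edges added are
those from representatives of target components to representatives of source components from which
they can be reached. -/
theorem Informed.mem_newEdges (h : Informed G c) (hord : ∀ r u l, (order r u l).Perm l)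
    (hG : (∀ s s', SourceRep G s → SourceRep G s' → s = s') ∨
      ∀ t t', TargetRep G t → TargetRep G t' → t = t') (t s : V) :
    (t, s) ∈ newEdges order c ↔ TargetRep G t ∧ SourceRep G s ∧ Reaches G s t := by
  refine h.mem_newEdges_of hord (fun s h1 => ?_) t s
  by_cases hs : SourceRep G s
  · rcases hG with hG | hG
    -- One source: each `R_t` has at most one element, so `s` cannot have selected anything.
    · refine absurd ?_ h1
      rw [h.phase3_of hs, runPhase3_val, findLarge_eq_none.2]
      intro p hp
      rw [((mem_inbox3 hord s p).1 hp).2]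
      exact length_le_one_of_nodup (h.phase2_nodup _) fun a ha b hb =>
        hG a b ((h.mem_phase2 _ _).1 ha).2.1 ((h.mem_phase2 _ _).1 hb).2.1
    -- One target: `s` has at most one proposer.
    · rw [← List.length_map Prod.fst, inbox3_fst]
      refine length_le_one_of_nodup (senders_nodup hord _ _ _) fun a ha b hb => ?_
      simp only [(hord _ _ _).mem_iff, Finset.mem_sort, Finset.mem_filter, Finset.mem_univ,
        true_and, h.mem_phase2] at ha hb
      exact hG a b ha.1 hb.1
  · rw [h.phase3_of_not hs] at h1
    simp at h1

end Phases

/-! ### Source and target components -/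

section Components

variable {V : Type} [LinearOrder V] {E : Finset (V × V)}

theorem EntersComp.congr {K : V × V → Prop} {u v : V} (h : Mutual K u v) (hu : EntersComp K u) :
    EntersComp K v := by
  obtain ⟨e, he, h1, h2⟩ := hu
  exact ⟨e, he, fun h3 => h1 (h.trans h3), h.symm.trans h2⟩

theorem LeavesComp.congr {K : V × V → Prop} {u v : V} (h : Mutual K u v) (hu : LeavesComp K u) :
    LeavesComp K v := by
  obtain ⟨e, he, h1, h2⟩ := hu
  exact ⟨e, he, h.symm.trans h1, fun h3 => h2 (h.trans h3)⟩

theorem IsRep.unique {K : V × V → Prop} {u v : V} (h : Mutual K u v) (hu : IsRep K u)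
    (hv : IsRep K v) : u = v :=
  le_antisymm (hu v h) (hv u h.symm)

theorem exists_isRep [Fintype V] (K : V × V → Prop) (v : V) : ∃ r, Mutual K v r ∧ IsRep K r := by
  classical
  obtain ⟨r, hr, hmin⟩ := Finset.exists_min_image (Finset.univ.filter fun w => Mutual K v w) id
    ⟨v, by simpa using Mutual.refl K v⟩
  simp only [Finset.mem_filter, Finset.mem_univ, true_and, id] at hr hmin
  exact ⟨r, hr, fun w hw => hmin w (hr.trans hw)⟩

theorem isSCC_mutual (v : V) : IsSCC E {w | Mutual (fun e => e ∈ E) v w} := by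
  refine ⟨fun a ha b hb _ => ?_, fun T hT hle w hw => ?_⟩
  · exact ha.symm.trans hb
  · by_cases h : v = w
    · subst h; exact Mutual.refl _ _
    · exact hT v (hle (Mutual.refl _ _)) w hw h

theorem IsSCC.eq_mutual {S : Set V} (h : IsSCC E S) {v : V} (hv : v ∈ S) :
    S = {w | Mutual (fun e => e ∈ E) v w} := by
  have h1 : S ⊆ {w | Mutual (fun e => e ∈ E) v w} := fun w hw => by
    by_cases hvw : v = w
    · subst hvw; exact Mutual.refl _ _
    · exact h.1 v hv w hw hvw
  exact h1.antisymm (h.2 (isSCC_mutual v).1 h1)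

theorem isSourceSCC_mutual {v : V} : IsSourceSCC E {w | Mutual (fun e => e ∈ E) v w} ↔
    LeavesComp (fun e => e ∈ E) v ∧ ¬ EntersComp (fun e => e ∈ E) v :=
  ⟨fun h => h.2, fun h => ⟨isSCC_mutual v, h⟩⟩

theorem isTargetSCC_mutual {v : V} : IsTargetSCC E {w | Mutual (fun e => e ∈ E) v w} ↔
    ¬ LeavesComp (fun e => e ∈ E) v ∧ EntersComp (fun e => e ∈ E) v :=
  ⟨fun h => h.2, fun h => ⟨isSCC_mutual v, h⟩⟩

theorem mutual_of_set_eq {u v : V} (h : {w | Mutual (fun e => e ∈ E) u w} =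
    {w | Mutual (fun e => e ∈ E) v w}) : Mutual (fun e => e ∈ E) u v := by
  have : v ∈ {w | Mutual (fun e => e ∈ E) v w} := Mutual.refl _ _
  rw [← h] at this
  exact this

theorem sourceRep_unique (h : numSourceSCCs E = 1) {s s' : V} (hs : SourceRep E s)
    (hs' : SourceRep E s') : s = s' := by
  obtain ⟨S, hS⟩ := Set.ncard_eq_one.1 h
  have h1 : ∀ v, SourceRep E v → {w | Mutual (fun e => e ∈ E) v w} = S := fun v hv => by
    have : {w | Mutual (fun e => e ∈ E) v w} ∈ {S | IsSourceSCC E S} :=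
      isSourceSCC_mutual.2 ⟨hv.2.1, hv.1⟩
    rw [hS] at this
    exact this
  exact IsRep.unique (mutual_of_set_eq ((h1 s hs).trans (h1 s' hs').symm)) hs.2.2 hs'.2.2

theorem targetRep_unique (h : numTargetSCCs E = 1) {t t' : V} (ht : TargetRep E t)
    (ht' : TargetRep E t') : t = t' := by
  obtain ⟨S, hS⟩ := Set.ncard_eq_one.1 h
  have h1 : ∀ v, TargetRep E v → {w | Mutual (fun e => e ∈ E) v w} = S := fun v hv => by
    have : {w | Mutual (fun e => e ∈ E) v w} ∈ {S | IsTargetSCC E S} :=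
      isTargetSCC_mutual.2 ⟨hv.2.1, hv.1⟩
    rw [hS] at this
    exact this
  exact IsRep.unique (mutual_of_set_eq ((h1 t ht).trans (h1 t' ht').symm)) ht.2.2 ht'.2.2

/-- A source or target component comes with an edge between different components. So the hypothesis
on the numbers excludes digraphs that are already strongly connected, where both are `0`. -/
theorem exists_not_mutual (h : numSourceSCCs E = 1 ∨ numTargetSCCs E = 1) :
    ∃ e ∈ E, ¬ Mutual (fun e => e ∈ E) e.1 e.2 := by
  rcases h with h | h
  · obtain ⟨S, hS⟩ := Set.ncard_eq_one.1 h
    have h1 : IsSourceSCC E S := by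
      have : S ∈ {S | IsSourceSCC E S} := by rw [hS]; rfl
      exact this
    obtain ⟨e, he, h2, h3⟩ := h1.2.1
    rw [h1.1.eq_mutual h2] at h3
    exact ⟨e, he, h3⟩
  · obtain ⟨S, hS⟩ := Set.ncard_eq_one.1 h
    have h1 : IsTargetSCC E S := by
      have : S ∈ {S | IsTargetSCC E S} := by rw [hS]; rfl
      exact this
    obtain ⟨e, he, h2, h3⟩ := h1.2.2
    rw [h1.1.eq_mutual h3] at h2
    exact ⟨e, he, fun h4 => h2 h4.symm⟩

/-- A weakly connected digraph with more than one component has no isolated component. -/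
theorem enters_or_leaves (hw : WeaklyConnected E)
    (h : ∃ e ∈ E, ¬ Mutual (fun e => e ∈ E) e.1 e.2) (u : V) :
    EntersComp (fun e => e ∈ E) u ∨ LeavesComp (fun e => e ∈ E) u := by
  by_contra! h1
  have h2 : ∀ v, Mutual (fun e => e ∈ E) u v := by
    intro v
    induction hw u v with
    | refl => exact Mutual.refl _ _
    | @tail b c _ hbc ih =>
      by_contra h3
      rcases hbc with hbc | hbc
      · exact h1.2 ⟨_, hbc, ih, h3⟩
      · exact h1.1 ⟨_, hbc, h3, ih⟩
  obtain ⟨e, -, h3⟩ := h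
  exact h3 ((h2 e.1).symm.trans (h2 e.2))

variable [Fintype V]

/-! ### Existence of reachable targets and reaching sources -/

theorem reaches_refl (E : Finset (V × V)) (u : V) : Reaches E u u := .refl

/-- Among the descendants of `u`, take one with fewest descendants. An edge leaving its component
would lead to a node with strictly fewer. -/
theorem exists_targetRep_of_reaches
    (h : ∀ u, EntersComp (fun e => e ∈ E) u ∨ LeavesComp (fun e => e ∈ E) u) (u : V) :
    ∃ t, TargetRep E t ∧ Reaches E u t := by
  classical
  obtain ⟨w, hw, hmin⟩ := Finset.exists_min_image (Finset.univ.filter fun w => Reaches E u w)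
    (fun w => (Finset.univ.filter fun x => Reaches E w x).card)
    ⟨u, by simpa using reaches_refl E u⟩
  simp only [Finset.mem_filter, Finset.mem_univ, true_and] at hw hmin
  have h1 : ¬ LeavesComp (fun e => e ∈ E) w := by
    rintro ⟨e, he, h2, h3⟩
    have h4 : Reaches E w e.2 := h2.1.tail he
    refine absurd (hmin e.2 (hw.trans h4)) (not_le.2 (Finset.card_lt_card ?_))
    refine (Finset.ssubset_iff_of_subset fun x => ?_).2 ⟨w, ?_, ?_⟩
    · simp only [Finset.mem_filter, Finset.mem_univ, true_and]
      exact fun h5 => h4.trans h5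
    · simpa using reaches_refl E w
    · simp only [Finset.mem_filter, Finset.mem_univ, true_and]
      exact fun h5 => h3 ⟨h4, h5⟩
  obtain ⟨r, hr, hrep⟩ := exists_isRep (fun e => e ∈ E) w
  exact ⟨r, ⟨((h w).resolve_right h1).congr hr, fun h2 => h1 (h2.congr hr.symm), hrep⟩,
    hw.trans hr.1⟩

/-- Dually, an ancestor of `u` with fewest ancestors lies in a source component. -/
theorem exists_sourceRep_reaches
    (h : ∀ u, EntersComp (fun e => e ∈ E) u ∨ LeavesComp (fun e => e ∈ E) u) (u : V) :
    ∃ s, SourceRep E s ∧ Reaches E s u := by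
  classical
  obtain ⟨w, hw, hmin⟩ := Finset.exists_min_image (Finset.univ.filter fun w => Reaches E w u)
    (fun w => (Finset.univ.filter fun x => Reaches E x w).card)
    ⟨u, by simpa using reaches_refl E u⟩
  simp only [Finset.mem_filter, Finset.mem_univ, true_and] at hw hmin
  have h1 : ¬ EntersComp (fun e => e ∈ E) w := by
    rintro ⟨e, he, h2, h3⟩
    have h4 : Reaches E e.1 w := .head he h3.2
    refine absurd (hmin e.1 (h4.trans hw)) (not_le.2 (Finset.card_lt_card ?_))
    refine (Finset.ssubset_iff_of_subset fun x => ?_).2 ⟨w, ?_, ?_⟩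
    · simp only [Finset.mem_filter, Finset.mem_univ, true_and]
      exact fun h5 => h5.trans h4
    · simpa using reaches_refl E w
    · simp only [Finset.mem_filter, Finset.mem_univ, true_and]
      exact fun h5 => h2 ⟨h5, h4⟩
  obtain ⟨r, hr, hrep⟩ := exists_isRep (fun e => e ∈ E) w
  exact ⟨r, ⟨fun h2 => h1 (h2.congr hr.symm), ((h w).resolve_left h1).congr hr, hrep⟩,
    hr.2.trans hw⟩

theorem exists_edge_leaving {r : V → V → Prop} {P : V → Prop} {a b : V}
    (h : Relation.ReflTransGen r a b) (ha : P a) (hb : ¬ P b) : ∃ c d, r c d ∧ P c ∧ ¬ P d := by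
  induction h with
  | refl => exact absurd ha hb
  | @tail c d _ hcd ih =>
    by_cases hc : P c
    · exact ⟨c, d, hcd, hc, hb⟩
    · exact ih hc

/-! ### Strongly connected digraphs and minimum augmentations -/

theorem StronglyConnected.reaches {F : Finset (V × V)} (h : StronglyConnected F) (u v : V) :
    Reaches F u v := by
  by_cases huv : u = v
  · subst huv; exact .refl
  · exact (h u v huv).1

theorem StronglyConnected.isolated {F : Finset (V × V)} (h : StronglyConnected F) (u : V) :
    ¬ EntersComp (fun e => e ∈ F) u ∧ ¬ LeavesComp (fun e => e ∈ F) u := by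
  have h1 : ∀ v, Mutual (fun e => e ∈ F) u v := fun v => ⟨h.reaches u v, h.reaches v u⟩
  exact ⟨fun ⟨_, _, h2, _⟩ => h2 (h1 _), fun ⟨_, _, _, h2⟩ => h2 (h1 _)⟩

/-- Every augmentation has an edge out of every target component. -/
theorem card_le_of_targetReps {F' A : Finset (V × V)} (hF' : StronglyConnected (E ∪ F'))
    (hA : ∀ e ∈ A, TargetRep E e.1) (hinj : ∀ e ∈ A, ∀ e' ∈ A, e.1 = e'.1 → e = e') :
    A.card ≤ F'.card := by
  have h1 : ∀ e ∈ A, ∃ f ∈ F', Mutual (fun e => e ∈ E) e.1 f.1 := by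
    intro e he
    obtain ⟨⟨x, -, h2, -⟩, h3, -⟩ := hA e he
    -- A path to a node outside the component must cross its boundary, and no edge of `E` does so.
    obtain ⟨c, d, hcd, hc, hd⟩ := exists_edge_leaving (P := Mutual (fun e => e ∈ E) e.1)
      (hF'.reaches e.1 x.1) (Mutual.refl _ _) h2
    rcases Finset.mem_union.1 hcd with hcd | hcd
    · exact absurd ⟨_, hcd, hc, hd⟩ h3
    · exact ⟨_, hcd, hc⟩
  choose! f hf hm using h1
  refine Finset.card_le_card_of_injOn f hf fun e he e' he' hee => ?_
  have h2 := hm e he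
  rw [hee] at h2
  exact hinj e he e' he' (IsRep.unique (h2.trans (hm e' he').symm) (hA e he).2.2 (hA e' he').2.2)

/-- Every augmentation has an edge into every source component. -/
theorem card_le_of_sourceReps {F' A : Finset (V × V)} (hF' : StronglyConnected (E ∪ F'))
    (hA : ∀ e ∈ A, SourceRep E e.2) (hinj : ∀ e ∈ A, ∀ e' ∈ A, e.2 = e'.2 → e = e') :
    A.card ≤ F'.card := by
  have h1 : ∀ e ∈ A, ∃ f ∈ F', Mutual (fun e => e ∈ E) e.2 f.2 := by
    intro e he
    obtain ⟨h3, ⟨x, -, -, h2⟩, -⟩ := hA e he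
    obtain ⟨c, d, hcd, hc, hd⟩ := exists_edge_leaving (P := fun v => ¬ Mutual (fun e => e ∈ E) e.2 v)
      (hF'.reaches x.2 e.2) h2 (not_not.2 (Mutual.refl _ _))
    rcases Finset.mem_union.1 hcd with hcd | hcd
    · exact absurd ⟨_, hcd, hc, not_not.1 hd⟩ h3
    · exact ⟨_, hcd, not_not.1 hd⟩
  choose! f hf hm using h1
  refine Finset.card_le_card_of_injOn f hf fun e he e' he' hee => ?_
  have h2 := hm e he
  rw [hee] at h2
  exact hinj e he e' he' (IsRep.unique (h2.trans (hm e' he').symm) (hA e he).2.2 (hA e' he').2.2)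

/-- Joining the representatives of the target components to those of the source components solves
the augmentation problem, if there is only one source component or only one target component. -/
theorem isMinAugmentation_of_mem_iff
    (h : ∀ u, EntersComp (fun e => e ∈ E) u ∨ LeavesComp (fun e => e ∈ E) u)
    (hE : (∀ s s', SourceRep E s → SourceRep E s' → s = s') ∨
      ∀ t t', TargetRep E t → TargetRep E t' → t = t') {F : Finset (V × V)}
    (hF : ∀ t s, (t, s) ∈ F ↔ TargetRep E t ∧ SourceRep E s ∧ Reaches E s t) :
    IsMinAugmentation E F ∧ F.card ≤ Fintype.card V := by
  -- If one kind of component is unique, the source that reaches `t`, or the target reached from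
  -- `s`, can only be the given one.
  have h1 : ∀ t s, TargetRep E t → SourceRep E s → Reaches E s t := by
    intro t s ht hs
    rcases hE with hE | hE
    · obtain ⟨s', hs', h2⟩ := exists_sourceRep_reaches h t
      rwa [hE s s' hs hs']
    · obtain ⟨t', ht', h2⟩ := exists_targetRep_of_reaches h s
      rwa [hE t t' ht ht']
  have h2 : ∀ u v, Reaches (E ∪ F) u v := by
    intro u v
    obtain ⟨t, ht, h3⟩ := exists_targetRep_of_reaches h u
    obtain ⟨s, hs, h4⟩ := exists_sourceRep_reaches h v
    have hmono : ∀ {a b}, Reaches E a b → Reaches (E ∪ F) a b := fun hab =>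
      Relation.ReflTransGen.mono (fun _ _ hxy => Finset.mem_union_left _ hxy) _ _ hab
    refine (hmono h3).trans (.head ?_ (hmono h4))
    exact Finset.mem_union_right _ ((hF t s).2 ⟨ht, hs, h1 t s ht hs⟩)
  have hT : ∀ e ∈ F, TargetRep E e.1 := fun e he => ((hF e.1 e.2).1 he).1
  have hS : ∀ e ∈ F, SourceRep E e.2 := fun e he => ((hF e.1 e.2).1 he).2.1
  rcases hE with hE | hE
  -- With one source representative, the tail determines the edge, so each target representative is
  -- the tail of at most one edge of `F`.
  · have hinj : ∀ e ∈ F, ∀ e' ∈ F, e.1 = e'.1 → e = e' := fun e he e' he' hee =>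
      Prod.ext hee (hE _ _ (hS e he) (hS e' he'))
    refine ⟨⟨fun u v _ => ⟨h2 u v, h2 v u⟩, fun F' hF' => card_le_of_targetReps hF' hT hinj⟩, ?_⟩
    rw [← Finset.card_univ]
    exact Finset.card_le_card_of_injOn Prod.fst (fun _ _ => Finset.mem_univ _) hinj
  · have hinj : ∀ e ∈ F, ∀ e' ∈ F, e.2 = e'.2 → e = e' := fun e he e' he' hee =>
      Prod.ext (hE _ _ (hT e he) (hT e' he')) hee
    refine ⟨⟨fun u v _ => ⟨h2 u v, h2 v u⟩, fun F' hF' => card_le_of_sourceReps hF' hS hinj⟩, ?_⟩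
    rw [← Finset.card_univ]
    exact Finset.card_le_card_of_injOn Prod.snd (fun _ _ => Finset.mem_univ _) hinj

/-- There are at least two nodes, so weak connectivity makes every node an end of some edge. -/
theorem card_le_two_mul_card (hw : WeaklyConnected E)
    (h : ∃ e ∈ E, ¬ Mutual (fun e => e ∈ E) e.1 e.2) : Fintype.card V ≤ 2 * E.card := by
  obtain ⟨x, -, hx⟩ := h
  have h1 : ∀ v : V, v ∈ E.image Prod.fst ∪ E.image Prod.snd := by
    intro v
    obtain ⟨w, hvw⟩ : ∃ w, w ≠ v := by
      by_contra! h2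
      exact hx (by rw [h2 x.1, h2 x.2]; exact Mutual.refl _ _)
    rw [Finset.mem_union, Finset.mem_image, Finset.mem_image]
    rcases Relation.ReflTransGen.cases_head (hw v w) with h2 | ⟨c, h2 | h2, -⟩
    · exact absurd h2.symm hvw
    · exact Or.inl ⟨_, h2, rfl⟩
    · exact Or.inr ⟨_, h2, rfl⟩
  rw [← Finset.card_univ, two_mul]
  refine (Finset.card_le_card fun v _ => h1 v).trans ((Finset.card_union_le _ _).trans ?_)
  exact add_le_add Finset.card_image_le Finset.card_image_le

end Components

/-! ### The course of the algorithm -/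

section Rounds

variable {V : Type} [Fintype V] [LinearOrder V] [Nonempty V] {E : Finset (V × V)}
  {order : ArrivalOrder V}

theorem step_of_propagating {c : Config V} (hex : ∀ u, c.exited u = false)
    (hc : ∃ u, c.propagating u = true) : step E order c = propagateStep E order c := by
  have h1 : ¬ ∀ u, c.exited u = true := fun h => by
    have := h (Classical.arbitrary V)
    simp [hex] at this
  rw [step, if_neg h1, if_pos hc]

theorem step_of_not_propagating {c : Config V} (hex : ∀ u, c.exited u = false)
    (hc : ¬ ∃ u, c.propagating u = true) : step E order c = finishRound E order c := by
  have h1 : ¬ ∀ u, c.exited u = true := fun h => by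
    have := h (Classical.arbitrary V)
    simp [hex] at this
  rw [step, if_neg h1, if_neg hc]

/-- A round consists of `K` iterations of edge propagation and one step for the other phases. -/
theorem exists_round_end (hord : ∀ r u l, (order r u l).Perm l) {c₀ : Config V}
    (h : PropInv E c₀ 0 c₀) (hex : ∀ u, c₀.exited u = false) :
    ∃ (K : ℕ) (c : Config V), PropInv E c₀ K c ∧ Informed (E ∪ c₀.added) c ∧
      K ≤ (E ∪ c₀.added).card + 1 ∧
      (∀ j ≤ K, PropInv E c₀ j ((step E order)^[j] c₀)) ∧
      (step E order)^[K] c₀ = c ∧ (step E order)^[K + 1] c₀ = finishRound E order c := by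
  classical
  have hinv := fun k => h.iterate hord hex k (order := order)
  -- An agent still active after `k` iterations knows at least `k` edges if `k ≥ 1`, so all have
  -- stopped by this bound.
  have hend : ∃ k, ¬ ∃ u, ((propagateStep E order)^[k] c₀).propagating u = true := by
    refine ⟨(E ∪ c₀.added).card + 1, ?_⟩
    rintro ⟨u, hu⟩
    have := (hinv _).le_card_of_propagating hu
    omega
  have hK := Nat.find_spec hend
  have hlt := fun j (hj : j < Nat.find hend) => not_not.1 (Nat.find_min hend hj)
  have hle : Nat.find hend ≤ (E ∪ c₀.added).card + 1 := by
    refine Nat.find_min' hend ?_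
    rintro ⟨u, hu⟩
    have := (hinv _).le_card_of_propagating hu
    omega
  generalize Nat.find hend = K at hK hlt hle
  have hex' : ∀ k u, ((propagateStep E order)^[k] c₀).exited u = false := fun k u => by
    rw [(hinv k).exited_eq, hex]
  have hrun : ∀ j ≤ K, (step E order)^[j] c₀ = (propagateStep E order)^[j] c₀ := by
    intro j
    induction j with
    | zero => intro _; rfl
    | succ j ih =>
      intro hj
      rw [Function.iterate_succ_apply', ih (by omega), Function.iterate_succ_apply',
        step_of_propagating (hex' j) (hlt j (by omega))]
  refine ⟨K, (propagateStep E order)^[K] c₀, hinv K, ⟨hex' K, (hinv K).knowsAncestors hex hK,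
    fun u => ((hinv K).valid u).nodup⟩, hle, fun j hj => ?_, hrun K le_rfl, ?_⟩
  · rw [hrun j hj]; exact hinv j
  · rw [Function.iterate_succ_apply', hrun K le_rfl, step_of_not_propagating (hex' K) hK]

theorem finishRound_added (c : Config V) :
    (finishRound E order c).added = c.added ∪ newEdges order c := rfl

theorem finishRound_round (c : Config V) :
    (finishRound E order c).round = c.round + 1 := rfl

theorem finishRound_exited (c : Config V) (u : V) :
    (finishRound E order c).exited u = true ↔ (phase1 c u).val.2 = Decision.exit := by
  simp only [finishRound, startRound]
  split <;> simp_all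

theorem finishRound_time_le (hord : ∀ r u l, (order r u l).Perm l) {G : Finset (V × V)}
    {c : Config V} (h : Informed G c) (hG : Fintype.card V ≤ 2 * G.card)
    (hE : 1 ≤ (E ∪ (finishRound E order c).added).card) (u : V) :
    (finishRound E order c).time u ≤ c.time u + 70 * (Fintype.card V * G.card) +
      4 * (Fintype.card V * (E ∪ (finishRound E order c).added).card) := by
  have h1 := h.round_time hord hG u
  have h2 := startRound_time_le E (c.round + 1) (finishRound E order c).added
    (fun u => c.time u + (phase1 c u).time + (phase2 c u).time + (phase3 order c u).time
      + (phase4 order c u).time) (fun u => match (phase1 c u).val.2 with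
      | Decision.exit => true
      | _ => false) hE u
  change (finishRound E order c).time u ≤ _ at h2
  omega

/-- All states of the algorithm, when there is only one source component or only one target
component. -/
theorem run_structure (hord : ∀ r u l, (order r u l).Perm l) (hw : WeaklyConnected E)
    (hE : numSourceSCCs E = 1 ∨ numTargetSCCs E = 1) :
    ∃ (F : Finset (V × V)) (K L : ℕ), IsMinAugmentation E F ∧
      (∀ n ≤ K, (run E order n).round = 0) ∧
      (∀ n, K < n → n ≤ L → (run E order n).round = 1 ∧ (run E order n).added = F) ∧ K < L ∧
      (∀ n, L < n → (run E order n).round = 2 ∧ (run E order n).added = F ∧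
        ∀ u, (run E order n).exited u = true) ∧
      ∀ n u, (run E order n).time u ≤ 352 * (Fintype.card V * E.card) := by
  have hne := exists_not_mutual hE
  have hEL := enters_or_leaves hw hne
  have huniq : (∀ s s', SourceRep E s → SourceRep E s' → s = s') ∨
      ∀ t t', TargetRep E t → TargetRep E t' → t = t' :=
    hE.imp (fun h _ _ => sourceRep_unique h) (fun h _ _ => targetRep_unique h)
  have hnm := card_le_two_mul_card hw hne
  have hm : 1 ≤ E.card := by
    obtain ⟨e, he, -⟩ := hne
    exact Finset.card_pos.2 ⟨e, he⟩
  have hinit : PropInv E (initial E) 0 (initial E) := propInv_startRound E 0 ∅ _ _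
  have hun : E ∪ (initial E).added = E := Finset.union_empty E
  obtain ⟨K, c, hc, hinf, hK, hj, hKc, hK1⟩ := exists_round_end hord hinit (fun _ => rfl)
  rw [hun] at hinf hK
  have hF := hinf.mem_newEdges hord huniq
  obtain ⟨hmin, hFcard⟩ := isMinAugmentation_of_mem_iff hEL huniq hF
  generalize hFdef : newEdges order c = F at *
  have hadd : (finishRound E order c).added = F := by
    rw [finishRound_added, hc.added_eq, hFdef]
    exact Finset.empty_union F
  have hround : (finishRound E order c).round = 1 := by
    rw [finishRound_round, hc.round_eq]; rfl
  -- At most one new edge per node, and `|V| ≤ 2 * |E|`.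
  have hG : (E ∪ F).card ≤ 3 * E.card := by
    have := Finset.card_union_le E F
    omega
  have hG1 : E.card ≤ (E ∪ F).card := Finset.card_le_card Finset.subset_union_left
  have hex : ∀ u, (finishRound E order c).exited u = false := by
    intro u
    rw [← Bool.not_eq_true, finishRound_exited, hinf.phase1_eq_exit]
    have := hEL u
    tauto
  have ht0 : ∀ u, (initial E).time u ≤ 4 * (Fintype.card V * E.card) := by
    intro u
    have h1 := startRound_time_le E 0 ∅ (fun _ => 0) (fun _ => false) (by rwa [Finset.union_empty]) u
    rw [Finset.union_empty] at h1
    change (initial E).time u ≤ _ at h1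
    omega
  have ht1 : ∀ j ≤ K, ∀ u, ((step E order)^[j] (initial E)).time u ≤
      15 * (Fintype.card V * E.card) := by
    intro j hjK u
    have h1 := (hj j hjK).time_le_mul (by rw [hun]; omega) (by rwa [hun]) u
    rw [hun] at h1
    have := ht0 u
    omega
  have hnG : Fintype.card V * (E ∪ F).card ≤ 3 * (Fintype.card V * E.card) := by
    refine (Nat.mul_le_mul_left _ hG).trans (le_of_eq ?_)
    ring
  -- 97 = 15 + 70 + 4 · 3: propagation with its start, the later work of round one, and the start of
  -- round two on up to `3 * |E|` edges.
  have ht2 : ∀ u, (finishRound E order c).time u ≤ 97 * (Fintype.card V * E.card) := by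
    intro u
    have h1 := finishRound_time_le (E := E) hord hinf hnm (by rw [hadd]; omega) u
    rw [hadd] at h1
    have h2 := ht1 K le_rfl u
    rw [hKc] at h2
    omega
  have hinit' : PropInv E (finishRound E order c) 0 (finishRound E order c) :=
    propInv_startRound E _ _ _ _
  obtain ⟨K', c', hc', hinf', hK', hj', hKc', hK1'⟩ := exists_round_end hord hinit' hex
  rw [hadd] at hinf' hK'
  have hiso := hmin.1.isolated
  have hnew : newEdges order c' = ∅ := by
    rw [Finset.eq_empty_iff_forall_notMem]
    rintro ⟨t, s⟩ hts
    have hnoT : ∀ t, ¬ TargetRep (E ∪ F) t := fun t h => (hiso t).1 h.1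
    -- Uniqueness of the target representative is vacuous here, as there is none.
    rw [hinf'.mem_newEdges hord (Or.inr fun t _ h => absurd h (hnoT t))] at hts
    exact hnoT t hts.1
  have hadd' : (finishRound E order c').added = F := by
    rw [finishRound_added, hc'.added_eq, hnew, hadd, Finset.union_empty]
  have hround' : (finishRound E order c').round = 2 := by
    rw [finishRound_round, hc'.round_eq, hround]
  have hex' : ∀ u, (finishRound E order c').exited u = true := by
    intro u
    rw [finishRound_exited, hinf'.phase1_eq_exit]
    exact hiso u
  have ht1' : ∀ j ≤ K', ∀ u, ((step E order)^[j] (finishRound E order c)).time u ≤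
      130 * (Fintype.card V * E.card) := by
    intro j hjK u
    have h1 := (hj' j hjK).time_le_mul (by rw [hadd]; omega) (by rw [hadd]; omega) u
    rw [hadd] at h1
    have := ht2 u
    omega
  have ht2' : ∀ u, (finishRound E order c').time u ≤ 352 * (Fintype.card V * E.card) := by
    intro u
    have h1 := finishRound_time_le (E := E) hord hinf' (by omega) (by rw [hadd']; omega) u
    rw [hadd'] at h1
    have h2 := ht1' K' le_rfl u
    rw [hKc'] at h2
    omega
  have hfinal : ∀ i, (step E order)^[i] (finishRound E order c') = finishRound E order c' :=
    Function.iterate_fixed (by rw [step, if_pos hex'])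
  have hrun1 : ∀ j, run E order (K + 1 + j) = (step E order)^[j] (finishRound E order c) := by
    intro j
    rw [run, Nat.add_comm, Function.iterate_add_apply, hK1]
  have hrun2 : ∀ j, run E order (K + 1 + (K' + 1 + j)) = finishRound E order c' := by
    intro j
    rw [hrun1, Nat.add_comm, Function.iterate_add_apply, hK1', hfinal]
  have hcases : ∀ n, n ≤ K ∨ (∃ j ≤ K', n = K + 1 + j) ∨ ∃ j, n = K + 1 + (K' + 1 + j) := by
    intro n
    rcases Nat.lt_or_ge K n with h1 | h1
    · rcases Nat.lt_or_ge (K + 1 + K') n with h2 | h2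
      · exact Or.inr (Or.inr ⟨n - (K + 1 + (K' + 1)), by omega⟩)
      · exact Or.inr (Or.inl ⟨n - (K + 1), by omega, by omega⟩)
    · exact Or.inl h1
  refine ⟨F, K, K + 1 + K', hmin, fun n hn => (hj n hn).round_eq, fun n hn hn' => ?_, by omega,
    fun n hn => ?_, fun n u => ?_⟩
  · obtain ⟨j, rfl⟩ : ∃ j, n = K + 1 + j := ⟨n - (K + 1), by omega⟩
    rw [hrun1]
    have h1 := hj' j (by omega)
    exact ⟨h1.round_eq.trans hround, h1.added_eq.trans hadd⟩
  · obtain ⟨j, rfl⟩ : ∃ j, n = K + 1 + (K' + 1 + j) := ⟨n - (K + 1 + (K' + 1)), by omega⟩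
    rw [hrun2]
    exact ⟨hround', hadd', hex'⟩
  · rcases hcases n with h1 | ⟨j, h1, rfl⟩ | ⟨j, rfl⟩
    · have := ht1 n h1 u
      change ((step E order)^[n] (initial E)).time u ≤ _
      omega
    · rw [hrun1]
      have := ht1' j h1 u
      omega
    · rw [hrun2]
      exact ht2' u

end Rounds

end DigraphAugmentation

theorem mainTheorem5 :
    ∃ C : ℕ, ∀ (V : Type) [Fintype V] [LinearOrder V] [Nonempty V] (E : Finset (V × V))
      (order : DigraphAugmentation.ArrivalOrder V),
      (∀ r u l, (order r u l).Perm l) →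
      DigraphAugmentation.WeaklyConnected E →
      (DigraphAugmentation.numSourceSCCs E = 1 ∨ DigraphAugmentation.numTargetSCCs E = 1) →
      -- after one round, a minimum set of edges that makes the digraph strongly connected is added
      (∃ n, (DigraphAugmentation.run E order n).round = 1 ∧
        DigraphAugmentation.IsMinAugmentation E (DigraphAugmentation.run E order n).added) ∧
      -- no edges are added after the first round
      (∀ n m, 1 ≤ (DigraphAugmentation.run E order n).round →
        1 ≤ (DigraphAugmentation.run E order m).round →
        (DigraphAugmentation.run E order n).added = (DigraphAugmentation.run E order m).added) ∧
      -- the algorithm terminates, at the end of the second round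
      (∃ n, (DigraphAugmentation.run E order n).round = 2 ∧
        ∀ u, (DigraphAugmentation.run E order n).exited u = true) ∧
      -- at all times, an agent has performed at most `C * |V| * |E|` elementary steps
      (∀ n u, (DigraphAugmentation.run E order n).time u ≤ C * (Fintype.card V * E.card)) := by
  refine ⟨352, fun V _ _ _ E order hord hw hE => ?_⟩
  obtain ⟨F, K, L, hmin, h0, h1, hKL, h2, ht⟩ := DigraphAugmentation.run_structure hord hw hE
  have hadd : ∀ n, 1 ≤ (DigraphAugmentation.run E order n).round →
      (DigraphAugmentation.run E order n).added = F := by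
    intro n hn
    rcases Nat.lt_or_ge K n with h3 | h3
    · rcases Nat.lt_or_ge L n with h4 | h4
      · exact (h2 n h4).2.1
      · exact (h1 n h3 h4).2
    · have := h0 n h3
      omega
  -- `L` is the last state before the second round is completed, and `L + 1` the first after it.
  refine ⟨⟨L, (h1 L hKL le_rfl).1, by rwa [(h1 L hKL le_rfl).2]⟩,
    fun n m hn hm => (hadd n hn).trans (hadd m hm).symm,
    ⟨L + 1, (h2 _ (Nat.lt_succ_self L)).1, (h2 _ (Nat.lt_succ_self L)).2.2⟩, ht⟩
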